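/- **Conventions.** A Boolean function is a map $f:\{0,1\}^n\to\{0,1\}$ with $n\ge 0$. A clone is a set of Boolean functions that contains all projections and is closed under composition; $[C]$ is the smallest clone containing $C$. A base is a finite set $C$ of Boolean functions. $S_1=[\{\nrightarrow\}]$ is the clone of 1-separating functions, where $x\nrightarrow y$ is $x\land\neg y$. CTL formulas over $C$ are built from atomic propositions $p_0,p_1,\dots$, the connectives in $C$, and the CTL operators $\mathrm{TL}=\{QO: Q\in\{\mathsf A,\mathsf E\},\ O\in\{\mathsf X,\mathsf F,\mathsf G,\mathsf U,\mathsf R\}\}$. For $T\subseteq \mathrm{TL}$ and $k\in\mathbb N$, $\mathcal B_k(C,T)$ is the set of CTL formulas over $C$ of temporal depth (nesting depth of CTL operators) at most $k$ that use only CTL operators in $T$ and their duals ($\mathsf A\leftrightarrow\mathsf E$, $\mathsf F\leftrightarrow\mathsf G$, $\mathsf U\leftrightarrow\mathsf R$, $\mathsf X\leftrightarrow\mathsf X$); $\mathcal B_k(T)=\mathcal B_k(\{\land,\lor,\neg\},T)$. The size $|\varphi|$ is the number of symbols of $\varphi$ in the notation $op(\varphi_1,\dots,\varphi_n)$, where each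 proposition, connective, CTL operator and parenthesis counts once. A model of $\varphi$ is a rooted Kripke structure $(W,R,V,w)$ in which every world has an $R$-successor and in which $\varphi$ is true at $w$ under the usual CTL semantics over infinite paths. Formulas $\varphi,\psi$ are *frame-equivalent* if for every model $(W,R,V,w)$ of $\varphi$ there is a model $(W,R,V',w)$ of $\psi$, and vice versa. The size of a model in which every world is reachable from the root is $|W|$; its extent is the greatest $n$ such that some infinite $R$-path visits $n+1$ distinct worlds (both are $\infty$ if not finite); minimal size and extent of models refer to such models. Formulas are written as words over a finite alphabet, with the indices of propositions in binary. A logspace machine is a deterministic Turing machine with a read-only input tape, a write-only one-way output tape, and finitely many work tapes that on every input word $x$ are restricted to size $O(\log|x|)$. $\mathrm{SAT}(\Phi)$ is the problem: given $\varphi\in\Phi$, has $\varphi$ a model? A logspace reduction from $\mathrm{SAT}(\Phi)$ to $\mathrm{SAT}(\Psi)$ is a logspace-computable map $r:\Phi\to\Psi$ such that $\varphi$ is satisfiable if and only if $r(\varphi)$ is. **Theorem.** Let $C$ be a base with $S_1\subseteq[C]$, let $k\in\mathbb N$ and $T\subseteq\mathrm{TL}$. 1. There are a map $\varphi\mapsto\varphi'$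 from $\mathcal B_k(T)$ to $\mathcal B_k(C,T)$, computable by a logspace machine, and a constant $c$ (depending only on $C,k,T$) such that, for every $\varphi\in\mathcal B_k(T)$, the formulas $\varphi$ and $\varphi'$ are frame-equivalent and $|\varphi'|\le c\,|\varphi|$. 2. Consequently $\mathrm{SAT}(\mathcal B_k(T))$ is logspace-reducible to $\mathrm{SAT}(\mathcal B_k(C,T))$. 3. Consequently there is a constant $c$ (depending only on $C,k,T$) such that, if $(\varphi_n)_{n\in\mathbb N}$ is a family of satisfiable formulas of $\mathcal B_k(T)$ and $\varphi_n$ has minimal model size $s(n)$ and minimal model extent $e(n)$, then there is a family $(\varphi'_n)_{n\in\mathbb N}$ of satisfiable formulas of $\mathcal B_k(C,T)$ with minimal model size $s(n)$, minimal model extent $e(n)$, and $|\varphi'_n|\le c\,|\varphi_n|$ for all $n$. -/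

import Mathlib

universe u

namespace CTLClone

/-! ### Boolean functions and clones -/

/-- A Boolean function together with its arity (which may be zero). -/
abbrev BoolFn : Type := Σ n : ℕ, (Fin n → Bool) → Bool

/-- Binary conjunction. -/
def andFn : BoolFn := ⟨2, fun x => x 0 && x 1⟩

/-- Binary disjunction. -/
def orFn : BoolFn := ⟨2, fun x => x 0 || x 1⟩

/-- Negation. -/
def notFn : BoolFn := ⟨1, fun x => !(x 0)⟩

/-- Negated implication: true exactly if the first argument is true and the second is false. -/
def nimpFn : BoolFn := ⟨2, fun x => x 0 && !(x 1)⟩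

/-- A clone: a set of Boolean functions that contains all projections to arguments and is closed
under composition. -/
structure IsClone (S : Set BoolFn) : Prop where
  proj_mem : ∀ (n : ℕ) (i : Fin n), (⟨n, fun x => x i⟩ : BoolFn) ∈ S
  comp_mem : ∀ (m n : ℕ) (f : (Fin m → Bool) → Bool) (g : Fin m → (Fin n → Bool) → Bool),
    (⟨m, f⟩ : BoolFn) ∈ S → (∀ i, (⟨n, g i⟩ : BoolFn) ∈ S) →
      (⟨n, fun x => f (fun i => g i x)⟩ : BoolFn) ∈ S

/-- The smallest clone containing `B`. -/
def cloneOf (B : Set BoolFn) : Set BoolFn := ⋂₀ {S | IsClone S ∧ B ⊆ S}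

/-- The clone of 1-separating functions, generated by negated implication. -/
def cloneS1 : Set BoolFn := cloneOf {nimpFn}

/-- The standard base of conjunction, disjunction and negation. -/
def stdBase : Finset BoolFn := {andFn, orFn, notFn}

/-! ### CTL formulas over a base -/

/-- The path quantifiers. -/
inductive PathQuant : Type
  | A
  | E

/-- The unary temporal operators. -/
inductive UnOp : Type
  | X
  | F
  | G

/-- The binary temporal operators. -/
inductive BinOp : Type
  | U
  | R

/-- The ten CTL operators: a path quantifier followed by a temporal operator. -/
inductive CTLOp : Type
  | un (Q : PathQuant) (O : UnOp)
  | bin (Q : PathQuant) (O : BinOp)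

def PathQuant.dual : PathQuant → PathQuant
  | .A => .E
  | .E => .A

def UnOp.dual : UnOp → UnOp
  | .X => .X
  | .F => .G
  | .G => .F

def BinOp.dual : BinOp → BinOp
  | .U => .R
  | .R => .U

def CTLOp.dual : CTLOp → CTLOp
  | .un Q O => .un Q.dual O.dual
  | .bin Q O => .bin Q.dual O.dual

/-- CTL formulas with Boolean connectives from the base `C`; the atomic propositions are
`p₀, p₁, p₂, …`. -/
inductive Formula (C : Finset BoolFn) : Type
  | prop (i : ℕ) : Formula C
  | conn (f : C) (args : Fin f.1.1 → Formula C) : Formula C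
  | un (Q : PathQuant) (O : UnOp) (φ : Formula C) : Formula C
  | bin (Q : PathQuant) (O : BinOp) (φ ψ : Formula C) : Formula C

namespace Formula

variable {C : Finset BoolFn}

/-- Temporal depth: the maximal nesting depth of CTL operators. -/
def depth : Formula C → ℕ
  | prop _ => 0
  | conn _ args => Finset.univ.sup fun i => depth (args i)
  | un _ _ φ => depth φ + 1
  | bin _ _ φ ψ => max (depth φ) (depth ψ) + 1

/-- All CTL operators in the formula belong to `T` or are duals of operators in `T`. -/
def UsesOnly (T : Set CTLOp) : Formula C → Prop
  | prop _ => True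
  | conn _ args => ∀ i, UsesOnly T (args i)
  | un Q O φ => (CTLOp.un Q O ∈ T ∨ (CTLOp.un Q O).dual ∈ T) ∧ UsesOnly T φ
  | bin Q O φ ψ =>
      (CTLOp.bin Q O ∈ T ∨ (CTLOp.bin Q O).dual ∈ T) ∧ UsesOnly T φ ∧ UsesOnly T ψ

/-- The length of a formula written in the notation `op(φ₁,…,φₙ)`: every proposition, Boolean
connective, CTL operator and parenthesis counts as one symbol. -/
def size : Formula C → ℕ
  | prop _ => 1
  | conn _ args => 3 + ∑ i, size (args i)
  | un _ _ φ => 3 + size φ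
  | bin _ _ φ ψ => 3 + size φ + size ψ

end Formula

/-- The fragment `B_k(C, T)`: formulas over the base `C` of temporal depth at most `k` whose CTL
operators are from `T` or dual to operators in `T`. -/
def Fragment (k : ℕ) (C : Finset BoolFn) (T : Set CTLOp) : Set (Formula C) :=
  {φ | φ.UsesOnly T ∧ φ.depth ≤ k}

/-! ### Kripke semantics -/

section Semantics

variable {W : Type u}

/-- Every world has a successor. -/
def IsSerial (R : W → W → Prop) : Prop := ∀ v, ∃ v', R v v'

/-- Infinite paths through the frame `(W, R)`. -/
def IsPath (R : W → W → Prop) (π : ℕ → W) : Prop := ∀ i, R (π i) (π (i + 1))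

/-- Every world is reachable from `w`. -/
def IsGenerable (R : W → W → Prop) (w : W) : Prop := ∀ v, Relation.ReflTransGen R w v

/-- Quantification over the paths with origin `w`. -/
def PathQuant.Holds (Q : PathQuant) (R : W → W → Prop) (w : W) (P : (ℕ → W) → Prop) : Prop :=
  match Q with
  | .A => ∀ π, IsPath R π → π 0 = w → P π
  | .E => ∃ π, IsPath R π ∧ π 0 = w ∧ P π

/-- Truth of a unary temporal operator on the path `π`, where `P` is the set of worlds in which
the argument is true. -/
def UnOp.Holds (O : UnOp) (P : W → Prop) (π : ℕ → W) : Prop :=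
  match O with
  | .X => P (π 1)
  | .F => ∃ i, P (π i)
  | .G => ∀ i, P (π i)

/-- Truth of a binary temporal operator on the path `π`, where `P₁` and `P₂` are the sets of
worlds in which the arguments are true. Release is the dual of until. -/
def BinOp.Holds (O : BinOp) (P₁ P₂ : W → Prop) (π : ℕ → W) : Prop :=
  match O with
  | .U => ∃ i, P₂ (π i) ∧ ∀ j < i, P₁ (π j)
  | .R => ∀ i, P₂ (π i) ∨ ∃ j < i, P₁ (π j)

/-- `Sat R V φ w`: the formula `φ` is true in the world `w` of the Kripke structure `(W, R, V)`. -/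
def Sat {C : Finset BoolFn} (R : W → W → Prop) (V : ℕ → Set W) : Formula C → W → Prop
  | .prop i => fun w => w ∈ V i
  | .conn f args => fun w =>
      ∃ b : Fin f.1.1 → Bool, f.1.2 b = true ∧ ∀ i, b i = true ↔ Sat R V (args i) w
  | .un Q O φ => fun w => Q.Holds R w (O.Holds (Sat R V φ))
  | .bin Q O φ ψ => fun w => Q.Holds R w (O.Holds (Sat R V φ) (Sat R V ψ))

/-- The extent of a frame: the greatest `n` such that some path visits `n + 1` distinct worlds
(`⊤` if there is no greatest one). -/
noncomputable def extent (R : W → W → Prop) : ℕ∞ :=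
  sSup {m | ∃ n : ℕ, m = n ∧ ∃ π, IsPath R π ∧ (n : ℕ∞) + 1 ≤ (Set.range π).encard}

end Semantics

/-- The formula has a serial rooted model. -/
def Satisfiable {C : Finset BoolFn} (φ : Formula C) : Prop :=
  ∃ (W : Type u) (R : W → W → Prop) (V : ℕ → Set W) (w : W), IsSerial R ∧ Sat R V φ w

/-- The two formulas have models on the same serial rooted frames: models of one become models of
the other by changing only the valuation. -/
def FrameEquivalent {C D : Finset BoolFn} (φ : Formula C) (ψ : Formula D) : Prop :=
  ∀ (W : Type u) (R : W → W → Prop) (w : W), IsSerial R →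
    ((∃ V : ℕ → Set W, Sat R V φ w) ↔ ∃ V' : ℕ → Set W, Sat R V' ψ w)

/-- The sizes of the models of `φ` in which every world is reachable from the root. -/
def modelSizes {C : Finset BoolFn} (φ : Formula C) : Set ℕ∞ :=
  {s | ∃ (W : Type u) (R : W → W → Prop) (V : ℕ → Set W) (w : W),
    IsSerial R ∧ IsGenerable R w ∧ Sat R V φ w ∧ s = ENat.card W}

/-- The extents of the models of `φ` in which every world is reachable from the root. -/
def modelExtents {C : Finset BoolFn} (φ : Formula C) : Set ℕ∞ :=
  {e | ∃ (W : Type u) (R : W → W → Prop) (V : ℕ → Set W) (w : W),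
    IsSerial R ∧ IsGenerable R w ∧ Sat R V φ w ∧ e = extent R}

/-! ### Formulas as words over a finite alphabet -/

/-- The finite alphabet used to write formulas over `C`. -/
inductive Sym (C : Finset BoolFn) : Type
  | prop
  | bit (b : Bool)
  | conn (f : C)
  | op (o : CTLOp)
  | lpar
  | rpar
  | comma

instance : Finite PathQuant :=
  Finite.of_surjective (fun b : Bool => if b then PathQuant.A else PathQuant.E)
    (fun q => by cases q; exacts [⟨true, rfl⟩, ⟨false, rfl⟩])

instance : Finite UnOp :=
  Finite.of_surjective (fun i : Fin 3 => match i with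
      | 0 => UnOp.X
      | 1 => UnOp.F
      | 2 => UnOp.G)
    (fun q => by cases q; exacts [⟨0, rfl⟩, ⟨1, rfl⟩, ⟨2, rfl⟩])

instance : Finite BinOp :=
  Finite.of_surjective (fun b : Bool => if b then BinOp.U else BinOp.R)
    (fun q => by cases q; exacts [⟨true, rfl⟩, ⟨false, rfl⟩])

instance : Finite CTLOp :=
  Finite.of_surjective
    (fun s : (PathQuant × UnOp) ⊕ (PathQuant × BinOp) => match s with
      | .inl p => CTLOp.un p.1 p.2
      | .inr p => CTLOp.bin p.1 p.2)
    (fun o => by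
      cases o with
      | un Q O => exact ⟨.inl (Q, O), rfl⟩
      | bin Q O => exact ⟨.inr (Q, O), rfl⟩)

instance (C : Finset BoolFn) : Finite (Sym C) :=
  Finite.of_surjective
    (fun s : Fin 4 ⊕ Bool ⊕ C ⊕ CTLOp => match s with
      | .inl 0 => Sym.prop
      | .inl 1 => Sym.lpar
      | .inl 2 => Sym.rpar
      | .inl 3 => Sym.comma
      | .inr (.inl b) => Sym.bit b
      | .inr (.inr (.inl f)) => Sym.conn f
      | .inr (.inr (.inr o)) => Sym.op o)
    (fun s => by
      cases s with
      | prop => exact ⟨.inl 0, rfl⟩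
      | lpar => exact ⟨.inl 1, rfl⟩
      | rpar => exact ⟨.inl 2, rfl⟩
      | comma => exact ⟨.inl 3, rfl⟩
      | bit b => exact ⟨.inr (.inl b), rfl⟩
      | conn f => exact ⟨.inr (.inr (.inl f)), rfl⟩
      | op o => exact ⟨.inr (.inr (.inr o)), rfl⟩)

/-- The word that writes down a formula: compound formulas as `op(φ₁,…,φₙ)`, and the proposition
`pᵢ` as the letter `prop` followed by the binary digits of `i`, least significant first. -/
def Formula.encode {C : Finset BoolFn} : Formula C → List (Sym C)
  | .prop i => Sym.prop :: (Nat.bits i).map Sym.bit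
  | .conn f args =>
      Sym.conn f :: Sym.lpar ::
        (List.intercalate [Sym.comma] (List.ofFn fun i => encode (args i)) ++ [Sym.rpar])
  | .un Q O φ => Sym.op (.un Q O) :: Sym.lpar :: (encode φ ++ [Sym.rpar])
  | .bin Q O φ ψ =>
      Sym.op (.bin Q O) :: Sym.lpar :: (encode φ ++ Sym.comma :: (encode ψ ++ [Sym.rpar]))

/-! ### Logarithmic space -/

/-- Directions of head movements. -/
inductive Dir : Type
  | left
  | stay
  | right

/-- The content of a cell of the input tape: an input letter or one of the two end markers. -/
inductive InCell (A : Type) : Type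
  | leftEnd
  | letter (a : A)
  | rightEnd

/-- A deterministic Turing machine with a read-only two-way input tape, `tapes` many read-write
work tapes and a write-only one-way output tape. It halts where the transition function is
`none`; otherwise it changes its state, moves the input head, writes to each work tape and moves
the head there, and writes at most one letter to the output tape. -/
structure Transducer (A B : Type) [Finite A] [Finite B] where
  State : Type
  finite_state : Finite State
  start : State
  Work : Type
  finite_work : Finite Work
  blank : Work
  tapes : ℕ
  trans : State → InCell A → (Fin tapes → Work) →
    Option (State × Dir × (Fin tapes → Work × Dir) × Option B)

namespace Transducer

variable {A B : Type} [Finite A] [Finite B]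

/-- Configurations. The work tapes are infinite to the right, and `output` is the content of the
output tape. On the input tape, cell `0` is the left end marker. -/
structure Cfg (M : Transducer A B) where
  state : M.State
  inputPos : ℕ
  work : Fin M.tapes → ℕ → M.Work
  head : Fin M.tapes → ℕ
  output : List B

/-- The content of cell `i` of the input tape on input `x`. -/
def inputCell (x : List A) (i : ℕ) : InCell A :=
  if i = 0 then .leftEnd
  else match x[i - 1]? with
    | some a => .letter a
    | none => .rightEnd

/-- Head movement on a tape that is infinite to the right; a left move in cell `0` has no effect. -/
def moveHead : Dir → ℕ → ℕ
  | .left, i => i - 1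
  | .stay, i => i
  | .right, i => i + 1

/-- The initial configuration. -/
def init (M : Transducer A B) : M.Cfg where
  state := M.start
  inputPos := 0
  work := fun _ _ => M.blank
  head := fun _ => 0
  output := []

/-- One step on input `x`. The input head does not move beyond the right end marker, which is in
cell `x.length + 1`. -/
def step (M : Transducer A B) (x : List A) (c : M.Cfg) : Option M.Cfg :=
  match M.trans c.state (inputCell x c.inputPos) (fun j => c.work j (c.head j)) with
  | none => none
  | some (q, d, act, o) => some
      { state := q
        inputPos := min (moveHead d c.inputPos) (x.length + 1)
        work := fun j => Function.update (c.work j) (c.head j) (act j).1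
        head := fun j => moveHead (act j).2 (c.head j)
        output := c.output ++ o.toList }

/-- `c` is a configuration that occurs in the computation on input `x`. -/
def Occurs (M : Transducer A B) (x : List A) (c : M.Cfg) : Prop :=
  Relation.ReflTransGen (fun c₁ c₂ => c₂ ∈ M.step x c₁) M.init c

/-- On every input `x`, the work tapes are restricted to size `O(log |x|)`. -/
def InLogspace (M : Transducer A B) : Prop :=
  ∃ c : ℕ, ∀ (x : List A) (cfg : M.Cfg), M.Occurs x cfg →
    ∀ j, cfg.head j < c * (Nat.log 2 x.length + 1)

/-- On input `x` the machine halts with `y` on the output tape. -/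
def Outputs (M : Transducer A B) (x : List A) (y : List B) : Prop :=
  ∃ cfg : M.Cfg, M.Occurs x cfg ∧ M.step x cfg = none ∧ cfg.output = y

end Transducer

/-- The function `f` between sets of objects that are written down by `ea` and `eb` as words over
finite alphabets is computable by a logspace Turing machine. -/
def LogspaceComputable {A B : Type} [Finite A] [Finite B] {α β : Type}
    (ea : α → List A) (eb : β → List B) (f : α → β) : Prop :=
  ∃ M : Transducer A B, M.InLogspace ∧ ∀ a, M.Outputs (ea a) (eb (f a))

/-- Logspace many-one reducibility of the decision problem `P` with instances in `α` to the
decision problem `P'` with instances in `β`. -/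
def LogspaceReducible {A B : Type} [Finite A] [Finite B] {α β : Type}
    (ea : α → List A) (P : Set α) (eb : β → List B) (P' : Set β) : Prop :=
  ∃ r : α → β, LogspaceComputable ea eb r ∧ ∀ a, a ∈ P ↔ r a ∈ P'

/-- The words that write down the formulas of a set of formulas. -/
def encodeIn {C : Finset BoolFn} (Φ : Set (Formula C)) (φ : Φ) : List (Sym C) :=
  φ.1.encode

/-- The satisfiability problem for a set `Φ` of formulas. -/
def SAT {C : Finset BoolFn} (Φ : Set (Formula C)) : Set Φ :=
  {φ | Satisfiable.{u} φ.1}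

end CTLClone

/-!
# Transferring CTL fragments to bases that generate the 1-separating functions

The constant true need not be definable over `C`, so a fresh proposition `p₀` plays its role, and
`pᵢ` is renamed to `p₂ᵢ₊₁`. Nothing can force `p₀` to be true in all relevant worlds, because the
operators in `T` may be too weak for that. Instead, negations are pushed to the propositions, using
the duals of the temporal operators, and the translation `Gadgets.tr` is arranged to be false
wherever `p₀` is: literals and temporal subformulas are conjoined with `p₀`, and the terms used for
conjunction and disjunction preserve false. As temporal operators are monotone, the translation then
implies the original formula in every model (`Gadgets.sat_of_sat_tr`), and it is equivalent to it if
`p₀` is true everywhere (`Gadgets.sat_tr_iff`). Hence both have models on the same frames.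

For a linear size, conjunction and disjunction relative to `p₀` are expressed by terms in which each
argument occurs once (`BTerm.exists_readOnce`). In the presence of the constants, they arise from a
connective that is not affine, which has a two-dimensional face of odd weight
(`exists_odd_face`), and from one that is not monotone, which yields negation
(`exists_decreasing_edge`). Conjunction with `p₀` over all valuations of `p₀` cannot in general be
done without copies (for instance over disjunction and exclusive disjunction), but it is needed
only at propositions and at temporal operators, and these are nested at most `k` deep
(`Gadgets.exists_size_tr_le`).

The translation is computed in one pass over the input. At a comma or closing parenthesis
the machine has to find the head symbol of the argument list, by counting parentheses; the copies to
be made of the temporal subformulas around the current position are recorded in a stack of height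
`k`, which is part of the finite state. So a transducer with one counter suffices
(`Words.leads_encode`). Its counter is bounded by the length of the input (`Words.ctr_le`), and
in binary notation it fits into logarithmic space (`CounterTransducer.logspaceComputable`).
-/

namespace CTLClone

/-! ### Boolean terms and the functions they define -/

/-- Boolean terms over the base `C` with variables from `V` and one further variable `top`, which
later stands for the proposition that plays the role of the constant true. -/
inductive BTerm (C : Finset BoolFn) (V : Type) : Type
  | top : BTerm C V
  | var (v : V) : BTerm C V
  | conn (f : C) (args : Fin f.1.1 → BTerm C V) : BTerm C V

namespace BTerm

variable {C : Finset BoolFn} {V V' : Type}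

/-- The value of a term if `top` has the value `t` and the variables have the values `b`. -/
def eval (t : Bool) (b : V → Bool) : BTerm C V → Bool
  | top => t
  | var v => b v
  | conn f args => f.1.2 fun i => eval t b (args i)

/-- Simultaneous substitution for the variables. -/
def bind (σ : V → BTerm C V') : BTerm C V → BTerm C V'
  | top => top
  | var v => σ v
  | conn f args => conn f fun i => bind σ (args i)

/-- The occurrences of variables, from left to right; `top` is not counted. -/
def vars : BTerm C V → List V
  | top => []
  | var v => [v]
  | conn _ args => (List.ofFn fun i => vars (args i)).flatten

theorem eval_bind (t : Bool) (b : V' → Bool) (σ : V → BTerm C V') (D : BTerm C V) :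
    (D.bind σ).eval t b = D.eval t fun v => (σ v).eval t b := by
  induction D with
  | top => rfl
  | var v => rfl
  | conn f args ih => simp only [bind, eval, ih]

/-- The functions defined by terms form a clone, hence every function in the generated clone is
defined by a term. -/
theorem exists_of_mem_cloneOf {n : ℕ} {g : (Fin n → Bool) → Bool}
    (h : (⟨n, g⟩ : BoolFn) ∈ cloneOf (C : Set BoolFn)) :
    ∃ D : BTerm C (Fin n), ∀ t b, D.eval t b = g b := by
  let S : Set BoolFn := {p | ∃ D : BTerm C (Fin p.1), ∀ t b, D.eval t b = p.2 b}
  refine h S ⟨⟨?_, ?_⟩, ?_⟩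
  · exact fun n i => ⟨var i, fun _ _ => rfl⟩
  · rintro m n f g ⟨D, hD⟩ hg
    choose E hE using hg
    exact ⟨D.bind E, fun t b => by simp only [eval_bind, hD, hE]⟩
  · exact fun f hf => ⟨conn ⟨f, hf⟩ var, fun _ _ => rfl⟩

theorem exists_nimp (hC : cloneS1 ⊆ cloneOf (C : Set BoolFn)) :
    ∃ D : BTerm C (Fin 2), ∀ t b, D.eval t b = (b 0 && !(b 1)) :=
  exists_of_mem_cloneOf (hC fun _ hS => hS.2 rfl)

end BTerm

/-! ### Boolean functions that are not affine or not monotone -/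

section Cube

variable {n : ℕ}

open Function

/-- Induction over the Boolean cube along its edges, from the bottom to the top. -/
theorem cube_induction {P : (Fin n → Bool) → Prop} (h0 : P fun _ => false)
    (hf : ∀ i a, a i = false → P a → P (update a i true)) (a : Fin n → Bool) : P a := by
  have key : ∀ s : Finset (Fin n), P fun i => decide (i ∈ s) := by
    intro s
    induction s using Finset.induction_on with
    | empty => simpa using h0
    | insert i s hi ih =>
      convert hf i _ (by simpa using hi) ih using 1
      funext j
      by_cases hj : j = i
      · subst hj; simp
      · simp [hj]
  simpa using key (Finset.univ.filter fun i => a i = true)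

/-- A function that never decreases when a single argument is raised is monotone; stated by
contraposition. -/
theorem exists_decreasing_edge {f : (Fin n → Bool) → Bool} {a d : Fin n → Bool}
    (h1 : f a = true) (h2 : f (fun i => a i || d i) = false) :
    ∃ i c, c i = false ∧ f c = true ∧ f (update c i true) = false := by
  by_contra! hcon
  have key : f (fun i => a i || d i) = true := by
    induction d using cube_induction with
    | h0 => simpa using h1
    | hf i d hd ih =>
      by_cases hfd : f (fun i => a i || d i) = false
      · exact absurd (ih hfd) (by simp [hfd])
      · have hfd : f (fun i => a i || d i) = true := by simpa using hfd
        have hu : (fun j => a j || update d i true j) = update (fun i => a i || d i) i true := by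
          funext j
          by_cases hj : j = i
          · subst hj; simp
          · simp [hj]
        rw [hu]
        by_cases hai : (a i || d i) = true
        · rwa [update_eq_self_iff.2 hai.symm]
        · simpa using hcon i _ (by simpa using hai) hfd
  simp [key] at h2

/-- A function whose values on every two-dimensional face of the cube sum to zero is affine;
stated by contraposition. -/
theorem exists_odd_face {f : (Fin n → Bool) → Bool} {x y z : Fin n → Bool}
    (h : f (fun i => x i ^^ y i ^^ z i) ≠ (f x ^^ f y ^^ f z)) :
    ∃ (i j : Fin n) (a : Fin n → Bool), i < j ∧
      (f (update (update a i false) j false) ^^ f (update (update a i false) j true) ^^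
        f (update (update a i true) j false) ^^ f (update (update a i true) j true)) = true := by
  by_contra! hcon
  let flip : Fin n → (Fin n → Bool) → Fin n → Bool := fun i a => update a i !(a i)
  have face : ∀ (i j : Fin n), i ≠ j → ∀ a,
      (f (flip i (flip j a)) ^^ f (flip j a)) = (f (flip i a) ^^ f a) := by
    have aux : ∀ i j : Fin n, i < j → ∀ a,
        (f a ^^ f (flip j a) ^^ f (flip i a) ^^ f (flip i (flip j a))) = false := by
      intro i j hij a
      have hne : i ≠ j := hij.ne
      have hc := hcon i j a hij
      rw [ne_eq, Bool.not_eq_true] at hc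
      have e1 : flip j a = update (update a i (a i)) j !(a j) := by
        simp [flip]
      have e2 : flip i a = update (update a i !(a i)) j (a j) := by
        have : a j = update a i (!(a i)) j := (update_of_ne hne.symm _ _).symm
        exact (update_eq_self_iff.2 this).symm
      have e3 : flip i (flip j a) = update (update a i !(a i)) j !(a j) := by
        simp only [flip, update_comm hne]
        simp [hne]
      have e0 : a = update (update a i (a i)) j (a j) := by simp
      rw [e3, e1, e2]
      nth_rewrite 1 [e0]
      rcases hi : a i <;> rcases hj : a j <;>
        simp only [Bool.not_false, Bool.not_true] <;> revert hc <;>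
        generalize f (update (update a i false) j false) = p₁ <;>
        generalize f (update (update a i false) j true) = p₂ <;>
        generalize f (update (update a i true) j false) = p₃ <;>
        generalize f (update (update a i true) j true) = p₄ <;>
        revert p₁ p₂ p₃ p₄ <;> decide
    intro i j hij a
    rcases lt_or_gt_of_ne hij with hlt | hlt
    · have := aux i j hlt a
      revert this
      cases f a <;> cases f (flip j a) <;> cases f (flip i a) <;> cases f (flip i (flip j a)) <;>
        decide
    · have := aux j i hlt a
      have e : flip j (flip i a) = flip i (flip j a) := by
        simp only [flip, update_of_ne hij, update_of_ne hij.symm]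
        exact update_comm hij _ _ _
      rw [e] at this
      revert this
      cases f a <;> cases f (flip j a) <;> cases f (flip i a) <;> cases f (flip i (flip j a)) <;>
        decide
  have hflip : ∀ (i : Fin n) (a : Fin n → Bool), a i = false → update a i true = flip i a := by
    intro i a ha; simp [flip, ha]
  -- The derivative in direction `i` is constant,
  have const : ∀ i a, (f (flip i a) ^^ f a) = (f (flip i fun _ => false) ^^ f fun _ => false) := by
    intro i a
    induction a using cube_induction with
    | h0 => rfl
    | hf j a ha ih =>
      rw [hflip j a ha, ← ih]
      by_cases hij : i = j
      · subst hij
        have : flip i (flip i a) = a := by simp [flip]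
        rw [this, Bool.xor_comm]
      · exact face i j hij a
  -- and so are the derivatives in all directions.
  have affine : ∀ d x y : Fin n → Bool,
      (f (fun i => x i ^^ d i) ^^ f x) = (f (fun i => y i ^^ d i) ^^ f y) := by
    intro d
    induction d using cube_induction with
    | h0 => intro x y; simp
    | hf j d hd ih =>
      intro x y
      have e : ∀ x : Fin n → Bool, (fun i => x i ^^ update d j true i) =
          flip j fun i => x i ^^ d i := by
        intro x
        funext i
        by_cases hi : i = j
        · subst hi; simp [flip, hd]
        · simp [flip, hi]
      have h1 := ih x y
      have h2 := (const j fun i => x i ^^ d i).trans (const j fun i => y i ^^ d i).symm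
      rw [e x, e y]
      revert h1 h2
      generalize f (flip j fun i => x i ^^ d i) = p1
      generalize f (flip j fun i => y i ^^ d i) = p2
      generalize f (fun i => x i ^^ d i) = p3
      generalize f (fun i => y i ^^ d i) = p4
      generalize f x = p5
      generalize f y = p6
      revert p1 p2 p3 p4 p5 p6
      decide
  have h3 := affine (fun i => y i ^^ z i) x y
  have e : (fun i => y i ^^ (y i ^^ z i)) = z := by funext i; simp
  simp only [e] at h3
  apply h
  have e' : (fun i => x i ^^ y i ^^ z i) = fun i => x i ^^ (y i ^^ z i) := by
    funext i; simp
  rw [e']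
  revert h3
  generalize f (fun i => x i ^^ (y i ^^ z i)) = p1
  cases p1 <;> cases f x <;> cases f y <;> cases f z <;> decide

/-- Every binary function of odd weight is a conjunction up to negation of the arguments and of
the value. -/
theorem exists_xor_eq_and (h : Bool → Bool → Bool)
    (odd : (h false false ^^ h false true ^^ h true false ^^ h true true) = true) :
    ∃ p q r, ∀ x y, (r ^^ h (p ^^ x) (q ^^ y)) = (x && y) := by
  revert h; decide

end Cube

/-! ### Terms in which every argument occurs once -/

theorem flatten_ofFn_single {α : Type} {n : ℕ} (i : Fin n) (l : List α) :
    (List.ofFn fun k => if k = i then l else []).flatten = l := by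
  induction n with
  | zero => exact i.elim0
  | succ n ih =>
    rw [List.ofFn_succ, List.flatten_cons]
    refine Fin.cases ?_ (fun i => ?_) i
    · simp [Fin.succ_ne_zero]
    · simp [(Fin.succ_ne_zero _).symm, ih]

theorem flatten_ofFn_pair {α : Type} {n : ℕ} (i j : Fin n) (hij : i < j) (l m : List α) :
    (List.ofFn fun k => if k = i then l else if k = j then m else []).flatten = l ++ m := by
  induction n with
  | zero => exact i.elim0
  | succ n ih =>
    rw [List.ofFn_succ, List.flatten_cons]
    obtain ⟨j, rfl⟩ := Fin.exists_succ_eq.2 (Fin.ne_zero_of_lt hij)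
    revert hij
    refine Fin.cases ?_ (fun i => ?_) i
    · intro _
      simp [Fin.succ_ne_zero, flatten_ofFn_single]
    · intro hij
      simp [(Fin.succ_ne_zero _).symm, ih i j (Fin.succ_lt_succ_iff.1 hij)]

namespace BTerm

variable {C : Finset BoolFn} {V : Type}

open Function

/-- Affine functions are closed under composition, but negated implication is not affine. -/
theorem exists_not_affine (hC : cloneS1 ⊆ cloneOf (C : Set BoolFn)) :
    ∃ (f : C) (x y z : Fin f.1.1 → Bool),
      f.1.2 (fun i => x i ^^ y i ^^ z i) ≠ (f.1.2 x ^^ f.1.2 y ^^ f.1.2 z) := by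
  by_contra! hcon
  obtain ⟨D, hD⟩ := exists_nimp hC
  have key : ∀ (D : BTerm C (Fin 2)) (x y z : Fin 2 → Bool),
      D.eval true (fun i => x i ^^ y i ^^ z i) =
        (D.eval true x ^^ D.eval true y ^^ D.eval true z) := by
    intro D x y z
    induction D with
    | top => rfl
    | var v => rfl
    | conn f args ih => simp only [eval, ih, hcon]
  have := key D ![false, false] ![true, false] ![false, true]
  simp [hD] at this

/-- Monotone functions are closed under composition, but negated implication is not monotone. -/
theorem exists_not_monotone (hC : cloneS1 ⊆ cloneOf (C : Set BoolFn)) :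
    ∃ (f : C) (a d : Fin f.1.1 → Bool), f.1.2 a = true ∧ f.1.2 (fun i => a i || d i) = false := by
  by_contra! hcon
  obtain ⟨D, hD⟩ := exists_nimp hC
  have key : ∀ (D : BTerm C (Fin 2)) (x y : Fin 2 → Bool), (∀ i, x i = true → y i = true) →
      D.eval true x = true → D.eval true y = true := by
    intro D x y hxy
    induction D with
    | top => exact id
    | var v => exact hxy v
    | conn f args ih =>
      intro h
      have h' := hcon f _ (fun i => eval true y (args i)) h
      have e : (fun i => eval true x (args i) || eval true y (args i)) =
          fun i => eval true y (args i) := by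
        funext i
        have := ih i
        revert this
        cases eval true x (args i) <;> simp
      rw [e] at h'
      simpa [eval] using h'
  have := key D ![true, false] ![true, true] (by intro i; fin_cases i <;> simp)
  simp [hD] at this

/-- The term with head symbol `f` in which the arguments `i` and `j` are `X` and `Y` and all others
are one of the terms `Z` and `I` for the constants. -/
theorem exists_face_term (f : C) (i j : Fin f.1.1) (hij : i < j) (a : Fin f.1.1 → Bool)
    (Z I X Y : BTerm C V) (hZ : Z.vars = []) (hI : I.vars = []) :
    ∃ D : BTerm C V, D.vars = X.vars ++ Y.vars ∧ ∀ t b, Z.eval t b = false → I.eval t b = true →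
      D.eval t b = f.1.2 (update (update a i (X.eval t b)) j (Y.eval t b)) := by
  refine ⟨conn f fun k => if k = i then X else if k = j then Y else if a k then I else Z,
    ?_, ?_⟩
  · rw [vars, ← flatten_ofFn_pair i j hij]
    congr 2
    funext k
    split_ifs <;> simp [hZ, hI]
  · intro t b h0 h1
    rw [eval]
    refine congrArg f.1.2 (funext fun k => ?_)
    by_cases hkj : k = j
    · subst hkj
      simp [hij.ne']
    · by_cases hki : k = i
      · subst hki; simp [hkj]
      · simp only [hkj, hki, if_false, update_of_ne, ne_eq, not_false_iff]
        cases a k <;> simp [h0, h1]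

/-- The term with head symbol `f` in which the argument `i` is `X` and all others are one of the
terms `Z` and `I` for the constants. -/
theorem exists_edge_term (f : C) (i : Fin f.1.1) (a : Fin f.1.1 → Bool)
    (Z I X : BTerm C V) (hZ : Z.vars = []) (hI : I.vars = []) :
    ∃ D : BTerm C V, D.vars = X.vars ∧ ∀ t b, Z.eval t b = false → I.eval t b = true →
      D.eval t b = f.1.2 (update a i (X.eval t b)) := by
  refine ⟨conn f fun k => if k = i then X else if a k then I else Z, ?_, ?_⟩
  · rw [vars, ← flatten_ofFn_single i X.vars]
    congr 2
    funext k
    split_ifs <;> simp [hZ, hI]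
  · intro t b h0 h1
    rw [eval]
    refine congrArg f.1.2 (funext fun k => ?_)
    by_cases hki : k = i
    · subst hki; simp
    · simp only [hki, if_false, update_of_ne, ne_eq, not_false_iff]
      cases a k <;> simp [h0, h1]

/-- Negation of a term without repeating it, in the presence of the constants. -/
theorem exists_xor_term (hC : cloneS1 ⊆ cloneOf (C : Set BoolFn)) (p : Bool)
    (Z I X : BTerm C V) (hZ : Z.vars = []) (hI : I.vars = []) :
    ∃ D : BTerm C V, D.vars = X.vars ∧ ∀ t b, Z.eval t b = false → I.eval t b = true →
      D.eval t b = (p ^^ X.eval t b) := by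
  cases p with
  | false => exact ⟨X, rfl, by simp⟩
  | true =>
    obtain ⟨f, a, d, h1, h2⟩ := exists_not_monotone hC
    obtain ⟨i, c, hci, h3, h4⟩ := exists_decreasing_edge h1 h2
    obtain ⟨D, hD, hE⟩ := exists_edge_term f i c Z I X hZ hI
    refine ⟨D, hD, fun t b h0 h1 => ?_⟩
    rw [hE t b h0 h1]
    cases X.eval t b
    · rw [← hci, update_eq_self, h3, hci]; rfl
    · rw [h4]; rfl

theorem exists_zero (hC : cloneS1 ⊆ cloneOf (C : Set BoolFn)) :
    ∃ Z : BTerm C V, Z.vars = [] ∧ ∀ t b, Z.eval t b = false := by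
  obtain ⟨D, hD⟩ := exists_nimp hC
  have hv : ∀ D : BTerm C (Fin 2), (D.bind fun _ => (top : BTerm C V)).vars = [] := by
    intro D
    induction D with
    | top => rfl
    | var v => rfl
    | conn f args ih => simp [bind, vars, ih]
  exact ⟨D.bind fun _ => top, hv D, fun t b => by simp [eval_bind, hD]⟩

/-- Either all connectives preserve false, and then `top` serves as the constant true; or the
constant true is definable. -/
theorem exists_one (hC : cloneS1 ⊆ cloneOf (C : Set BoolFn)) :
    ∃ I : BTerm C V, I.vars = [] ∧ (∀ b, I.eval true b = true) ∧
      ((∀ b, I.eval false b = true) ∨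
        ∀ D : BTerm C V, D.eval false (fun _ => false) = false) := by
  by_cases h : ∃ f : C, f.1.2 (fun _ => false) = true
  · obtain ⟨f, hf⟩ := h
    obtain ⟨Z, hZ, hZ'⟩ := exists_zero (V := V) hC
    exact ⟨conn f fun _ => Z, by simp [vars, hZ], by simp [eval, hZ', hf],
      Or.inl (by simp [eval, hZ', hf])⟩
  · push Not at h
    refine ⟨top, rfl, fun _ => rfl, Or.inr fun D => ?_⟩
    induction D with
    | top => rfl
    | var v => rfl
    | conn f args ih => simpa [eval, ih] using h f

/-- Conjunction (`s = true`) and disjunction (`s = false`) are definable, relative to `top`, by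
terms in which both arguments occur exactly once. Where `top` is false these terms may define
another function, but one that preserves false. -/
theorem exists_readOnce (hC : cloneS1 ⊆ cloneOf (C : Set BoolFn)) (s : Bool) :
    ∃ D : BTerm C Bool, D.vars = [false, true] ∧
      (∀ b, D.eval true b = if s then b false && b true else b false || b true) ∧
      D.eval false (fun _ => false) = false := by
  obtain ⟨Z, hZ, hZ'⟩ := exists_zero (V := Bool) hC
  obtain ⟨I, hI, hI', hI''⟩ := exists_one (V := Bool) hC
  obtain ⟨f, x, y, z, hf⟩ := exists_not_affine hC
  obtain ⟨i, j, a, hij, hodd⟩ := exists_odd_face hf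
  obtain ⟨p, q, r, h⟩ := exists_xor_eq_and
    (fun x y => f.1.2 (update (update a i x) j y)) hodd
  obtain ⟨X, hX, hX'⟩ := exists_xor_term hC (p ^^ !s) Z I (var false) hZ hI
  obtain ⟨Y, hY, hY'⟩ := exists_xor_term hC (q ^^ !s) Z I (var true) hZ hI
  obtain ⟨H, hH, hH'⟩ := exists_face_term f i j hij a Z I X Y hZ hI
  obtain ⟨D, hD, hD'⟩ := exists_xor_term hC (r ^^ !s) Z I H hZ hI
  -- Disjunction is obtained from conjunction by De Morgan's law.
  have key : ∀ t b, I.eval t b = true →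
      D.eval t b = if s then b false && b true else b false || b true := by
    intro t b ht
    rw [hD' t b (hZ' t b) ht, hH' t b (hZ' t b) ht, hX' t b (hZ' t b) ht, hY' t b (hZ' t b) ht]
    simp only [eval]
    cases s
    · have e : ∀ p x : Bool, (p ^^ !x) = (p ^^ true ^^ x) := by decide
      have e' : ∀ r x y u : Bool, (r ^^ u) = (!x && !y) → (r ^^ true ^^ u) = (x || y) := by decide
      have := h (!(b false)) (!(b true))
      rw [e p, e q] at this
      exact e' _ _ _ _ this
    · simpa using h (b false) (b true)
  refine ⟨D, by rw [hD, hH, hX, hY]; rfl, fun b => key true b (hI' b), ?_⟩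
  rcases hI'' with h1 | h0
  · rw [key false _ (h1 _)]; cases s <;> rfl
  · exact h0 D

/-- The literals relative to `top`: the conjunction of `top` with the argument (`s = true`) or its
negation (`s = false`). -/
theorem exists_literal (hC : cloneS1 ⊆ cloneOf (C : Set BoolFn)) (s : Bool) :
    ∃ D : BTerm C Unit, ∀ t b, D.eval t b = (t && (b () == s)) := by
  obtain ⟨D, hD⟩ := exists_nimp hC
  cases s
  · exact ⟨D.bind ![top, var ()], fun t b => by simp [eval_bind, hD, eval]⟩
  · refine ⟨D.bind ![top, D.bind ![top, var ()]], fun t b => ?_⟩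
    simp only [eval_bind, hD]
    simp [eval_bind, hD, eval]
    cases t <;> simp

end BTerm

/-! ### Formulas over the standard base -/

namespace Formula

/-- Negation as a connective of the standard base. -/
def notC : stdBase := ⟨notFn, Finset.mem_insert_of_mem (Finset.mem_insert_of_mem
  (Finset.mem_singleton_self _))⟩

/-- Conjunction as a connective of the standard base. -/
def andC : stdBase := ⟨andFn, Finset.mem_insert_self _ _⟩

/-- Disjunction as a connective of the standard base. -/
def orC : stdBase := ⟨orFn, Finset.mem_insert_of_mem (Finset.mem_insert_self _ _)⟩

/-- Negation of a formula over the standard base. -/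
def notF (φ : Formula stdBase) : Formula stdBase := conn notC fun _ => φ

/-- Conjunction of formulas over the standard base. -/
def andF (φ ψ : Formula stdBase) : Formula stdBase := conn andC fun i => if i.1 = 0 then φ else ψ

/-- Disjunction of formulas over the standard base. -/
def orF (φ ψ : Formula stdBase) : Formula stdBase := conn orC fun i => if i.1 = 0 then φ else ψ

theorem std_induction {P : Formula stdBase → Prop} (hprop : ∀ i, P (prop i))
    (hnot : ∀ φ, P φ → P (notF φ)) (hand : ∀ φ ψ, P φ → P ψ → P (andF φ ψ))
    (hor : ∀ φ ψ, P φ → P ψ → P (orF φ ψ)) (hun : ∀ Q O φ, P φ → P (un Q O φ))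
    (hbin : ∀ Q O φ ψ, P φ → P ψ → P (bin Q O φ ψ)) (φ : Formula stdBase) : P φ := by
  induction φ with
  | prop i => exact hprop i
  | conn f args ih =>
    have e : ∀ args : Fin 2 → Formula stdBase,
        (fun i => if i.1 = 0 then args 0 else args 1) = args := by
      intro args
      funext i
      fin_cases i <;> rfl
    have hf : f = andC ∨ f = orC ∨ f = notC := by
      obtain ⟨f, hf⟩ := f
      simp only [Subtype.ext_iff]
      simpa [stdBase, andC, orC, notC] using hf
    rcases hf with rfl | rfl | rfl
    · exact congrArg (fun a => P (conn andC a)) (e args) ▸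
        hand _ _ (ih (0 : Fin 2)) (ih (1 : Fin 2))
    · exact congrArg (fun a => P (conn orC a)) (e args) ▸
        hor _ _ (ih (0 : Fin 2)) (ih (1 : Fin 2))
    · have e' : (fun _ => args (0 : Fin 1)) = args :=
        funext fun i => congrArg args (Subsingleton.elim (α := Fin 1) 0 i)
      exact congrArg (fun a => P (conn notC a)) e' ▸ hnot _ (ih (0 : Fin 1))
  | un Q O φ ih => exact hun Q O φ ih
  | bin Q O φ ψ ih₁ ih₂ => exact hbin Q O φ ψ ih₁ ih₂

section Lemmas

variable (φ ψ : Formula stdBase)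

theorem depth_notF : (notF φ).depth = φ.depth := by
  rw [notF, depth]; exact Finset.sup_const ⟨(0 : Fin 1), Finset.mem_univ _⟩ _

theorem sup_fin_two (f : Fin 2 → ℕ) : Finset.univ.sup f = max (f 0) (f 1) := by
  rw [Fin.univ_succ]; simp

theorem depth_andF : (andF φ ψ).depth = max φ.depth ψ.depth := by
  rw [andF, depth]; exact sup_fin_two _

theorem depth_orF : (orF φ ψ).depth = max φ.depth ψ.depth := by
  rw [orF, depth]; exact sup_fin_two _

theorem usesOnly_notF (T : Set CTLOp) : (notF φ).UsesOnly T ↔ φ.UsesOnly T := by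
  rw [notF, UsesOnly]; exact ⟨fun h => h (0 : Fin 1), fun h _ => h⟩

theorem usesOnly_andF (T : Set CTLOp) :
    (andF φ ψ).UsesOnly T ↔ φ.UsesOnly T ∧ ψ.UsesOnly T := by
  rw [andF, UsesOnly]; exact Fin.forall_fin_two

theorem usesOnly_orF (T : Set CTLOp) :
    (orF φ ψ).UsesOnly T ↔ φ.UsesOnly T ∧ ψ.UsesOnly T := by
  rw [orF, UsesOnly]; exact Fin.forall_fin_two

theorem size_notF : (notF φ).size = 3 + φ.size := by
  rw [notF, size]; exact congrArg (3 + ·) (Fin.sum_univ_one _)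

theorem size_andF : (andF φ ψ).size = 3 + (φ.size + ψ.size) := by
  rw [andF, size]; exact congrArg (3 + ·) (Fin.sum_univ_two _)

theorem size_orF : (orF φ ψ).size = 3 + (φ.size + ψ.size) := by
  rw [orF, size]; exact congrArg (3 + ·) (Fin.sum_univ_two _)

variable {W : Type u} (R : W → W → Prop) (V : ℕ → Set W) (w : W)

theorem sat_notF : Sat R V (notF φ) w ↔ ¬ Sat R V φ w := by
  classical
  rw [notF, Sat]
  constructor
  · rintro ⟨b, hb, h⟩
    rw [← h (0 : Fin 1)]
    have hb : (!(b (0 : Fin 1))) = true := hb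
    simpa using hb
  · intro h
    exact ⟨fun _ => false, rfl, fun _ => by simpa using h⟩

theorem sat_andF : Sat R V (andF φ ψ) w ↔ Sat R V φ w ∧ Sat R V ψ w := by
  classical
  rw [andF, Sat]
  constructor
  · rintro ⟨b, hb, h⟩
    have h0 := h (0 : Fin 2)
    have h1 := h (1 : Fin 2)
    have hb : (b (0 : Fin 2) && b (1 : Fin 2)) = true := hb
    rw [Bool.and_eq_true] at hb
    exact ⟨h0.1 hb.1, h1.1 hb.2⟩
  · rintro ⟨h0, h1⟩
    exact ⟨fun _ => true, rfl, Fin.forall_fin_two.2 ⟨by simpa using h0, by simpa using h1⟩⟩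

theorem sat_orF : Sat R V (orF φ ψ) w ↔ Sat R V φ w ∨ Sat R V ψ w := by
  classical
  rw [orF, Sat]
  constructor
  · rintro ⟨b, hb, h⟩
    have h0 := h (0 : Fin 2)
    have h1 := h (1 : Fin 2)
    have hb : (b (0 : Fin 2) || b (1 : Fin 2)) = true := hb
    rw [Bool.or_eq_true] at hb
    exact hb.imp h0.1 h1.1
  · intro h01
    refine ⟨fun i => if i.1 = 0 then decide (Sat R V φ w) else decide (Sat R V ψ w), ?_,
      Fin.forall_fin_two.2 ⟨by simp, by simp⟩⟩
    change (decide (Sat R V φ w) || decide (Sat R V ψ w)) = true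
    simpa using h01

end Lemmas

end Formula

/-! ### Temporal operators: monotonicity and duality -/

section Temporal

variable {W : Type u} {R : W → W → Prop} {w : W}

theorem PathQuant.holds_mono (Q : PathQuant) {P P' : (ℕ → W) → Prop} (h : ∀ π, P π → P' π) :
    Q.Holds R w P → Q.Holds R w P' := by
  cases Q
  · exact fun H π h1 h2 => h π (H π h1 h2)
  · exact fun ⟨π, h1, h2, h3⟩ => ⟨π, h1, h2, h π h3⟩

theorem UnOp.holds_mono (O : UnOp) {P P' : W → Prop} (h : ∀ v, P v → P' v) (π : ℕ → W) :
    O.Holds P π → O.Holds P' π := by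
  cases O
  · exact h _
  · exact fun ⟨i, hi⟩ => ⟨i, h _ hi⟩
  · exact fun H i => h _ (H i)

theorem BinOp.holds_mono (O : BinOp) {P₁ P₁' P₂ P₂' : W → Prop} (h₁ : ∀ v, P₁ v → P₁' v)
    (h₂ : ∀ v, P₂ v → P₂' v) (π : ℕ → W) : O.Holds P₁ P₂ π → O.Holds P₁' P₂' π := by
  cases O
  · exact fun ⟨i, hi, H⟩ => ⟨i, h₂ _ hi, fun j hj => h₁ _ (H j hj)⟩
  · exact fun H i => (H i).imp (h₂ _) fun ⟨j, hj, hj'⟩ => ⟨j, hj, h₁ _ hj'⟩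

theorem PathQuant.not_holds (Q : PathQuant) (P : (ℕ → W) → Prop) :
    ¬ Q.Holds R w P ↔ Q.dual.Holds R w fun π => ¬ P π := by
  cases Q <;> simp [PathQuant.Holds, PathQuant.dual]

theorem UnOp.not_holds (O : UnOp) (P : W → Prop) (π : ℕ → W) :
    ¬ O.Holds P π ↔ O.dual.Holds (fun v => ¬ P v) π := by
  cases O <;> simp [UnOp.Holds, UnOp.dual]

theorem BinOp.not_holds (O : BinOp) (P₁ P₂ : W → Prop) (π : ℕ → W) :
    ¬ O.Holds P₁ P₂ π ↔ O.dual.Holds (fun v => ¬ P₁ v) (fun v => ¬ P₂ v) π := by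
  cases O
  · simp only [BinOp.Holds, BinOp.dual, not_exists, not_and, not_forall, exists_prop]
    exact forall_congr' fun i => imp_iff_not_or
  · simp only [BinOp.Holds, BinOp.dual, not_exists, not_and, not_forall, not_or]

/-- The path quantifier itself (`s = true`) or its dual (`s = false`). -/
def PathQuant.pol (s : Bool) (Q : PathQuant) : PathQuant := if s then Q else Q.dual

/-- The operator itself (`s = true`) or its dual (`s = false`). -/
def UnOp.pol (s : Bool) (O : UnOp) : UnOp := if s then O else O.dual

/-- The operator itself (`s = true`) or its dual (`s = false`). -/
def BinOp.pol (s : Bool) (O : BinOp) : BinOp := if s then O else O.dual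

theorem un_holds_pol (s : Bool) (Q : PathQuant) (O : UnOp) (P : W → Prop) :
    (Q.pol s).Holds R w ((O.pol s).Holds fun v => (P v ↔ s = true)) ↔
      (Q.Holds R w (O.Holds P) ↔ s = true) := by
  cases s
  · have e : (fun π => ¬ O.Holds P π) = O.dual.Holds fun v => ¬ P v :=
      funext fun π => propext (O.not_holds P π)
    simp [PathQuant.pol, UnOp.pol, Q.not_holds, e]
  · simp [PathQuant.pol, UnOp.pol]

theorem bin_holds_pol (s : Bool) (Q : PathQuant) (O : BinOp) (P₁ P₂ : W → Prop) :
    (Q.pol s).Holds R w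
        ((O.pol s).Holds (fun v => (P₁ v ↔ s = true)) fun v => (P₂ v ↔ s = true)) ↔
      (Q.Holds R w (O.Holds P₁ P₂) ↔ s = true) := by
  cases s
  · have e : (fun π => ¬ O.Holds P₁ P₂ π) =
        O.dual.Holds (fun v => ¬ P₁ v) fun v => ¬ P₂ v :=
      funext fun π => propext (O.not_holds P₁ P₂ π)
    simp [PathQuant.pol, BinOp.pol, Q.not_holds, e]
  · simp [PathQuant.pol, BinOp.pol]

end Temporal

/-! ### Substituting formulas into terms -/

namespace BTerm

variable {C : Finset BoolFn} {V : Type}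

/-- The formula obtained from a term by substituting formulas for the variables and the
proposition `p₀` for `top`. -/
def inst (σ : V → Formula C) : BTerm C V → Formula C
  | top => .prop 0
  | var v => σ v
  | conn f args => .conn f fun i => inst σ (args i)

open Classical in
theorem sat_inst {W : Type u} (R : W → W → Prop) (val : ℕ → Set W) (w : W) (σ : V → Formula C)
    (D : BTerm C V) :
    Sat R val (D.inst σ) w ↔
      D.eval (decide (w ∈ val 0)) (fun v => decide (Sat R val (σ v) w)) = true := by
  induction D with
  | top => simp [inst, eval, Sat]
  | var v => simp [inst, eval]
  | conn f args ih =>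
    simp only [inst, eval, Sat, ih]
    constructor
    · rintro ⟨b, hb, h⟩
      rw [← hb]
      exact congrArg f.1.2 (funext fun i => (Bool.eq_iff_iff.2 (h i)).symm)
    · exact fun h => ⟨_, h, fun i => Iff.rfl⟩

theorem depth_inst_le {n : ℕ} (σ : V → Formula C) (D : BTerm C V) (h : ∀ v, (σ v).depth ≤ n) :
    (D.inst σ).depth ≤ n := by
  induction D with
  | top => simp [inst, Formula.depth]
  | var v => exact h v
  | conn f args ih =>
    rw [inst, Formula.depth]
    exact Finset.sup_le fun i _ => ih i

theorem usesOnly_inst {T : Set CTLOp} (σ : V → Formula C) (D : BTerm C V)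
    (h : ∀ v, (σ v).UsesOnly T) : (D.inst σ).UsesOnly T := by
  induction D with
  | top => trivial
  | var v => exact h v
  | conn f args ih => exact ih

theorem exists_size_inst (D : BTerm C V) :
    ∃ c, ∀ σ : V → Formula C, (D.inst σ).size = c + (D.vars.map fun v => (σ v).size).sum := by
  induction D with
  | top => exact ⟨1, fun σ => rfl⟩
  | var v => exact ⟨0, fun σ => by simp [inst, vars]⟩
  | conn f args ih =>
    choose c hc using ih
    refine ⟨3 + ∑ i, c i, fun σ => ?_⟩
    rw [inst, Formula.size]
    simp only [hc, Finset.sum_add_distrib, vars, List.map_flatten, List.sum_flatten, List.map_ofFn,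
      List.sum_ofFn, Function.comp_apply, add_assoc]

end BTerm

/-! ### The translation -/

theorem CTLOp.dual_dual (o : CTLOp) : o.dual.dual = o := by
  rcases o with ⟨Q, O⟩ | ⟨Q, O⟩ <;> cases Q <;> cases O <;> rfl

/-- Terms for the Boolean part of the translation: read-once terms `bool true` and `bool false` for
conjunction and disjunction relative to `top`, and terms `lit s` for literals. -/
structure Gadgets (C : Finset BoolFn) where
  bool : Bool → BTerm C Bool
  lit : Bool → BTerm C Unit
  vars_bool : ∀ s, (bool s).vars = [false, true]
  eval_bool : ∀ s b, (bool s).eval true b = if s then b false && b true else b false || b true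
  eval_bool_false : ∀ s, (bool s).eval false (fun _ => false) = false
  eval_lit : ∀ s t b, (lit s).eval t b = (t && (b () == s))

theorem exists_gadgets {C : Finset BoolFn} (hC : cloneS1 ⊆ cloneOf (C : Set BoolFn)) :
    Nonempty (Gadgets C) := by
  choose b h1 h2 h3 using BTerm.exists_readOnce hC
  choose l h4 using BTerm.exists_literal hC
  exact ⟨⟨b, l, h1, h2, h3, h4⟩⟩

namespace Gadgets

variable {C : Finset BoolFn} (τ : Gadgets C)

/-- The translation of a formula with head symbol `f` from the translations `r s i` of its
arguments. -/
def trConn (f : BoolFn) (s : Bool) (r : Bool → ℕ → Formula C) : Formula C :=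
  if f = notFn then r (!s) 0
  else (τ.bool (if f = andFn then s else !s)).inst fun b => r s (if b then 1 else 0)

/-- The translation of a formula (`s = true`) or of its negation (`s = false`), relative to the
proposition `p₀`. Negations are pushed to the propositions, using the duals of the temporal
operators. The proposition `pᵢ` becomes `p₂ᵢ₊₁`, whose binary index is that of `pᵢ` with one digit
put in front. -/
def tr : Formula stdBase → Bool → Formula C
  | .prop i => fun s => (τ.lit s).inst fun _ => .prop (2 * i + 1)
  | .conn f args => fun s =>
      τ.trConn f.1 s fun s' i => if h : i < f.1.1 then tr (args ⟨i, h⟩) s' else .prop 0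
  | .un Q O φ => fun s => (τ.lit true).inst fun _ => .un (Q.pol s) (O.pol s) (tr φ s)
  | .bin Q O φ ψ => fun s =>
      (τ.lit true).inst fun _ => .bin (Q.pol s) (O.pol s) (tr φ s) (tr ψ s)

theorem andFn_ne_notFn : andFn ≠ notFn := fun h => absurd (congrArg Sigma.fst h) (by decide)

theorem orFn_ne_notFn : orFn ≠ notFn := fun h => absurd (congrArg Sigma.fst h) (by decide)

theorem orFn_ne_andFn : orFn ≠ andFn := by
  intro h
  have h := eq_of_heq (Sigma.mk.inj h).2
  have := congrFun h ![true, false]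
  simp at this

theorem trConn_notFn (s : Bool) (r : Bool → ℕ → Formula C) :
    τ.trConn notFn s r = r (!s) 0 := if_pos rfl

theorem trConn_andFn (s : Bool) (r : Bool → ℕ → Formula C) :
    τ.trConn andFn s r = (τ.bool s).inst fun b => r s (if b then 1 else 0) := by
  rw [trConn, if_neg andFn_ne_notFn, if_pos rfl]

theorem trConn_orFn (s : Bool) (r : Bool → ℕ → Formula C) :
    τ.trConn orFn s r = (τ.bool !s).inst fun b => r s (if b then 1 else 0) := by
  rw [trConn, if_neg orFn_ne_notFn, if_neg orFn_ne_andFn]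

theorem tr_notF (φ : Formula stdBase) (s : Bool) : τ.tr φ.notF s = τ.tr φ !s := by
  rw [Formula.notF, tr]
  exact (τ.trConn_notFn _ _).trans (dif_pos Nat.zero_lt_one)

theorem tr_andF (φ ψ : Formula stdBase) (s : Bool) :
    τ.tr (φ.andF ψ) s = (τ.bool s).inst fun b => if b then τ.tr ψ s else τ.tr φ s := by
  rw [Formula.andF, tr]
  refine (τ.trConn_andFn _ _).trans (congrArg (BTerm.inst · _) (funext fun b => ?_))
  cases b
  · exact dif_pos Nat.zero_lt_two
  · exact dif_pos Nat.one_lt_two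

theorem tr_orF (φ ψ : Formula stdBase) (s : Bool) :
    τ.tr (φ.orF ψ) s = (τ.bool !s).inst fun b => if b then τ.tr ψ s else τ.tr φ s := by
  rw [Formula.orF, tr]
  refine (τ.trConn_orFn _ _).trans (congrArg (BTerm.inst · _) (funext fun b => ?_))
  cases b
  · exact dif_pos Nat.zero_lt_two
  · exact dif_pos Nat.one_lt_two

theorem usesOnly_tr {T : Set CTLOp} {φ : Formula stdBase} (h : φ.UsesOnly T) (s : Bool) :
    (τ.tr φ s).UsesOnly T := by
  induction φ using Formula.std_induction generalizing s with
  | hprop i => exact BTerm.usesOnly_inst _ _ fun _ => trivial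
  | hnot φ ih => rw [tr_notF]; exact ih ((Formula.usesOnly_notF _ _).1 h) _
  | hand φ ψ ih₁ ih₂ =>
    rw [Formula.usesOnly_andF] at h
    rw [tr_andF]
    exact BTerm.usesOnly_inst _ _ fun b => by cases b; exacts [ih₁ h.1 s, ih₂ h.2 s]
  | hor φ ψ ih₁ ih₂ =>
    rw [Formula.usesOnly_orF] at h
    rw [tr_orF]
    exact BTerm.usesOnly_inst _ _ fun b => by cases b; exacts [ih₁ h.1 s, ih₂ h.2 s]
  | hun Q O φ ih =>
    refine BTerm.usesOnly_inst _ _ fun _ => ⟨?_, ih h.2 s⟩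
    cases s
    · have := CTLOp.dual_dual (.un Q O)
      rw [CTLOp.dual] at this
      exact h.1.symm.imp id (fun h => this.symm ▸ h)
    · exact h.1
  | hbin Q O φ ψ ih₁ ih₂ =>
    refine BTerm.usesOnly_inst _ _ fun _ => ⟨?_, ih₁ h.2.1 s, ih₂ h.2.2 s⟩
    cases s
    · have := CTLOp.dual_dual (.bin Q O)
      rw [CTLOp.dual] at this
      exact h.1.symm.imp id (fun h => this.symm ▸ h)
    · exact h.1

theorem depth_tr_le (φ : Formula stdBase) (s : Bool) : (τ.tr φ s).depth ≤ φ.depth := by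
  induction φ using Formula.std_induction generalizing s with
  | hprop i => exact BTerm.depth_inst_le _ _ fun _ => le_rfl
  | hnot φ ih => rw [tr_notF, Formula.depth_notF]; exact ih _
  | hand φ ψ ih₁ ih₂ =>
    rw [tr_andF, Formula.depth_andF]
    exact BTerm.depth_inst_le _ _ fun b => by
      cases b
      exacts [(ih₁ s).trans (le_max_left _ _), (ih₂ s).trans (le_max_right _ _)]
  | hor φ ψ ih₁ ih₂ =>
    rw [tr_orF, Formula.depth_orF]
    exact BTerm.depth_inst_le _ _ fun b => by
      cases b
      exacts [(ih₁ s).trans (le_max_left _ _), (ih₂ s).trans (le_max_right _ _)]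
  | hun Q O φ ih => exact BTerm.depth_inst_le _ _ fun _ => Nat.succ_le_succ (ih s)
  | hbin Q O φ ψ ih₁ ih₂ =>
    exact BTerm.depth_inst_le _ _ fun _ => Nat.succ_le_succ (max_le_max (ih₁ s) (ih₂ s))

/-- Only the temporal operators multiply the size by a constant, so that the size is linear for
bounded temporal depth. -/
theorem exists_size_tr_le :
    ∃ K : ℕ, ∀ φ s, (τ.tr φ s).size ≤ K ^ (φ.depth + 1) * φ.size := by
  choose cb hb using fun s => BTerm.exists_size_inst (τ.bool s)
  choose cl hl using fun s => BTerm.exists_size_inst (τ.lit s)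
  have hb' : ∀ s (σ : Bool → Formula C),
      ((τ.bool s).inst σ).size = cb s + ((σ false).size + (σ true).size) := by
    intro s σ
    rw [hb, τ.vars_bool]
    simp
  have hl' : ∀ s (ψ : Formula C),
      ((τ.lit s).inst fun _ => ψ).size = cl s + (τ.lit s).vars.length * ψ.size := by
    intro s ψ
    rw [hl]
    simp
  let M := cb false + cb true + cl false + cl true + (τ.lit false).vars.length +
    (τ.lit true).vars.length + 1
  have hM1 : ∀ s, cb s ≤ M := by intro s; cases s <;> simp only [M] <;> omega
  have hM2 : ∀ s, cl s ≤ M := by intro s; cases s <;> simp only [M] <;> omega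
  have hM3 : ∀ s, (τ.lit s).vars.length ≤ M := by intro s; cases s <;> simp only [M] <;> omega
  have hM : 1 ≤ M := by simp only [M]; omega
  clear_value M
  have hpow : ∀ n, M ≤ (2 * M) ^ (n + 1) := by
    intro n
    calc M ≤ 2 * M := by omega
      _ ≤ (2 * M) ^ (n + 1) := Nat.le_self_pow (by omega) _
  have hmono : ∀ {m n : ℕ}, m ≤ n → (2 * M) ^ (m + 1) ≤ (2 * M) ^ (n + 1) := by
    intro m n h
    exact Nat.pow_le_pow_right (by omega) (by omega)
  -- The three symbols of a connective pay for the constant part of a Boolean gadget,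
  have bool_le : ∀ (s : Bool) (φ ψ : Formula stdBase) (φ' ψ' : Formula C) (m n : ℕ),
      φ'.size ≤ (2 * M) ^ (m + 1) * φ.size → ψ'.size ≤ (2 * M) ^ (n + 1) * ψ.size →
      cb s + (φ'.size + ψ'.size) ≤ (2 * M) ^ (max m n + 1) * (3 + (φ.size + ψ.size)) := by
    intro s φ ψ φ' ψ' m n h1 h2
    have h1' := h1.trans (Nat.mul_le_mul_right _ (hmono (le_max_left m n)))
    have h2' := h2.trans (Nat.mul_le_mul_right _ (hmono (le_max_right m n)))
    have h3 := hM1 s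
    have h4 := hpow (max m n)
    rw [mul_add, mul_add]
    omega
  -- and those of a temporal operator for the constant part of the copied operator.
  have temp_le : ∀ n a b : ℕ, a ≤ (2 * M) ^ (n + 1) * b →
      cl true + (τ.lit true).vars.length * (3 + a) ≤ (2 * M) ^ (n + 1 + 1) * (3 + b) := by
    intro n a b h
    have h2 := hM2 true
    have h3 := hM3 true
    have h4 := hpow n
    calc cl true + (τ.lit true).vars.length * (3 + a)
        ≤ M + M * (3 + (2 * M) ^ (n + 1) * b) := by gcongr
      _ = M * (4 + (2 * M) ^ (n + 1) * b) := by ring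
      _ ≤ M * (2 * (2 * M) ^ (n + 1) * (3 + b)) := by
          gcongr
          have : 1 ≤ (2 * M) ^ (n + 1) := hM.trans h4
          nlinarith
      _ = (2 * M) ^ (n + 1 + 1) * (3 + b) := by ring
  refine ⟨2 * M, fun φ => ?_⟩
  induction φ using Formula.std_induction with
  | hprop i =>
    intro s
    rw [tr, hl']
    have h2 := hM2 s
    have h3 := hM3 s
    simp only [Formula.size, Formula.depth, zero_add, pow_one, mul_one]
    omega
  | hnot φ ih =>
    intro s
    rw [tr_notF, Formula.depth_notF, Formula.size_notF]
    exact (ih _).trans (Nat.mul_le_mul_left _ (by omega))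
  | hand φ ψ ih₁ ih₂ =>
    intro s
    rw [tr_andF, Formula.depth_andF, Formula.size_andF, hb']
    exact bool_le s φ ψ _ _ _ _ (ih₁ s) (ih₂ s)
  | hor φ ψ ih₁ ih₂ =>
    intro s
    rw [tr_orF, Formula.depth_orF, Formula.size_orF, hb']
    exact bool_le _ φ ψ _ _ _ _ (ih₁ s) (ih₂ s)
  | hun Q O φ ih =>
    intro s
    rw [tr, hl']
    exact temp_le _ _ _ (ih s)
  | hbin Q O φ ψ ih₁ ih₂ =>
    intro s
    rw [tr, hl']
    simp only [Formula.size, Formula.depth, add_assoc 3]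
    refine temp_le _ _ _ ?_
    have h1' := (ih₁ s).trans (Nat.mul_le_mul_right _ (hmono (le_max_left φ.depth ψ.depth)))
    have h2' := (ih₂ s).trans (Nat.mul_le_mul_right _ (hmono (le_max_right φ.depth ψ.depth)))
    rw [mul_add]
    omega

/-! ### Frame equivalence -/

section Semantics

variable {W : Type u} {R : W → W → Prop} {V V' : ℕ → Set W}

theorem sat_lit (s : Bool) (ψ : Formula C) (w : W) :
    Sat R V ((τ.lit s).inst fun _ => ψ) w ↔ w ∈ V 0 ∧ (Sat R V ψ w ↔ s = true) := by
  classical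
  rw [BTerm.sat_inst, τ.eval_lit]
  cases s <;> simp

theorem sat_bool {s : Bool} {φ ψ : Formula C} {w : W} (hw : w ∈ V 0) :
    Sat R V ((τ.bool s).inst fun b => if b then ψ else φ) w ↔
      if s then Sat R V φ w ∧ Sat R V ψ w else Sat R V φ w ∨ Sat R V ψ w := by
  classical
  rw [BTerm.sat_inst, decide_eq_true hw, τ.eval_bool]
  cases s <;> simp

theorem not_sat_bool {s : Bool} {φ ψ : Formula C} {w : W} (hw : w ∉ V 0)
    (h₁ : ¬ Sat R V φ w) (h₂ : ¬ Sat R V ψ w) :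
    ¬ Sat R V ((τ.bool s).inst fun b => if b then ψ else φ) w := by
  classical
  have e : (fun b => decide (Sat R V (if b then ψ else φ) w)) = fun _ : Bool => false := by
    funext b
    cases b
    · exact decide_eq_false h₁
    · exact decide_eq_false h₂
  rw [BTerm.sat_inst, decide_eq_false hw, e, τ.eval_bool_false]
  simp

/-- Translations are false wherever `p₀` is. -/
theorem mem_of_sat_tr {φ : Formula stdBase} {s : Bool} {w : W} (h : Sat R V (τ.tr φ s) w) :
    w ∈ V 0 := by
  induction φ using Formula.std_induction generalizing s with
  | hprop i => exact ((τ.sat_lit s _ w).1 h).1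
  | hnot φ ih => rw [tr_notF] at h; exact ih h
  | hand φ ψ ih₁ ih₂ =>
    rw [tr_andF] at h
    by_contra hw
    exact τ.not_sat_bool hw (fun h => hw (ih₁ h)) (fun h => hw (ih₂ h)) h
  | hor φ ψ ih₁ ih₂ =>
    rw [tr_orF] at h
    by_contra hw
    exact τ.not_sat_bool hw (fun h => hw (ih₁ h)) (fun h => hw (ih₂ h)) h
  | hun Q O φ ih => exact ((τ.sat_lit true _ w).1 h).1
  | hbin Q O φ ψ ih₁ ih₂ => exact ((τ.sat_lit true _ w).1 h).1

/-- Translations imply the formulas they translate, whatever the valuation of `p₀`. -/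
theorem sat_of_sat_tr (hV : ∀ i, V i = V' (2 * i + 1)) {φ : Formula stdBase} {s : Bool} {w : W}
    (h : Sat R V' (τ.tr φ s) w) : Sat R V φ w ↔ s = true := by
  have hw := τ.mem_of_sat_tr h
  induction φ using Formula.std_induction generalizing s w with
  | hprop i =>
    have := ((τ.sat_lit s _ w).1 h).2
    rwa [Sat, ← hV] at this
  | hnot φ ih =>
    rw [tr_notF] at h
    have := ih h hw
    rw [Formula.sat_notF]
    cases s <;> simpa using this
  | hand φ ψ ih₁ ih₂ =>
    rw [tr_andF, τ.sat_bool hw] at h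
    rw [Formula.sat_andF]
    cases s
    · rcases h with h | h
      · simp [ih₁ h hw]
      · simp [ih₂ h hw]
    · simp [ih₁ h.1 hw, ih₂ h.2 hw]
  | hor φ ψ ih₁ ih₂ =>
    rw [tr_orF, τ.sat_bool hw] at h
    rw [Formula.sat_orF]
    cases s
    · simp [ih₁ h.1 hw, ih₂ h.2 hw]
    · rcases h with h | h
      · simp [ih₁ h hw]
      · simp [ih₂ h hw]
  | hun Q O φ ih =>
    have h' := ((τ.sat_lit true _ w).1 h).2.2 rfl
    refine (un_holds_pol s Q O (Sat R V φ)).1 (PathQuant.holds_mono _ (UnOp.holds_mono _ ?_) h')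
    exact fun v hv => ih hv (τ.mem_of_sat_tr hv)
  | hbin Q O φ ψ ih₁ ih₂ =>
    have h' := ((τ.sat_lit true _ w).1 h).2.2 rfl
    refine (bin_holds_pol s Q O (Sat R V φ) (Sat R V ψ)).1
      (PathQuant.holds_mono _ (BinOp.holds_mono _ ?_ ?_) h')
    · exact fun v hv => ih₁ hv (τ.mem_of_sat_tr hv)
    · exact fun v hv => ih₂ hv (τ.mem_of_sat_tr hv)

/-- Where `p₀` is true everywhere, translations are equivalent to the formulas they translate. -/
theorem sat_tr_iff (hV : ∀ i, V i = V' (2 * i + 1)) (h0 : ∀ w, w ∈ V' 0) (φ : Formula stdBase)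
    (s : Bool) (w : W) : Sat R V' (τ.tr φ s) w ↔ (Sat R V φ w ↔ s = true) := by
  induction φ using Formula.std_induction generalizing s w with
  | hprop i =>
    rw [tr, τ.sat_lit, and_iff_right (h0 w), Sat, Sat, hV]
  | hnot φ ih =>
    rw [tr_notF, Formula.sat_notF, ih]
    cases s <;> simp
  | hand φ ψ ih₁ ih₂ =>
    rw [tr_andF, τ.sat_bool (h0 w), Formula.sat_andF, ih₁, ih₂]
    cases s <;> simp [imp_iff_not_or]
  | hor φ ψ ih₁ ih₂ =>
    rw [tr_orF, τ.sat_bool (h0 w), Formula.sat_orF, ih₁, ih₂]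
    cases s <;> simp
  | hun Q O φ ih =>
    rw [tr, τ.sat_lit, and_iff_right (h0 w), iff_true_right rfl, Sat, Sat, ← un_holds_pol]
    simp only [funext fun v => propext (ih s v)]
  | hbin Q O φ ψ ih₁ ih₂ =>
    rw [tr, τ.sat_lit, and_iff_right (h0 w), iff_true_right rfl, Sat, Sat, ← bin_holds_pol]
    simp only [funext fun v => propext (ih₁ s v), funext fun v => propext (ih₂ s v)]

end Semantics

theorem frameEquivalent_tr (φ : Formula stdBase) : FrameEquivalent.{u} φ (τ.tr φ true) := by
  intro W R w _
  constructor
  · rintro ⟨V, h⟩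
    -- `p₀` is made true everywhere, and `p₂ᵢ₊₁` takes over the valuation of `pᵢ`.
    let V' : ℕ → Set W := fun i => if i = 0 then Set.univ else V (i / 2)
    refine ⟨V', (τ.sat_tr_iff (V := V) (fun i => ?_) (fun w => ?_) φ true w).2 (by simpa using h)⟩
    · have : (2 * i + 1) / 2 = i := by omega
      simp [V', this]
    · simp [V']
  · rintro ⟨V', h⟩
    exact ⟨fun i => V' (2 * i + 1), (τ.sat_of_sat_tr (fun _ => rfl) h).2 rfl⟩

end Gadgets

/-! ### Transducers with one counter -/

theorem finite_words (B : Type) [Finite B] (n : ℕ) : Finite {l : List B // l.length ≤ n} :=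
  List.finite_length_le B n

/-- What a counter machine does to its counter in one step. -/
inductive CtrOp : Type
  | keep
  | inc
  | dec

/-- The effect on the value of the counter; zero is not decreased. -/
def CtrOp.apply : CtrOp → ℕ → ℕ
  | keep, n => n
  | inc, n => n + 1
  | dec, n => n - 1

instance : Finite CtrOp :=
  Finite.of_surjective (fun i : Fin 3 => match i with
      | 0 => CtrOp.keep
      | 1 => CtrOp.inc
      | 2 => CtrOp.dec)
    (fun q => by cases q; exacts [⟨0, rfl⟩, ⟨1, rfl⟩, ⟨2, rfl⟩])

/-- A deterministic transducer with a two-way input tape and one counter that can be tested for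
zero (the Boolean argument of `trans`). It may write a word of bounded length in one step. -/
structure CounterTransducer (A B : Type) where
  State : Type
  finite_state : Finite State
  start : State
  trans : State → InCell A → Bool → Option (State × Dir × CtrOp × List B)
  maxOut : ℕ
  length_le : ∀ q c z r, trans q c z = some r → r.2.2.2.length ≤ maxOut

namespace CounterTransducer

variable {A B : Type}

/-- Configurations of a counter machine. -/
structure Cfg (M : CounterTransducer A B) where
  state : M.State
  pos : ℕ
  ctr : ℕ
  out : List B

/-- One step on input `x`. -/
def step (M : CounterTransducer A B) (x : List A) (c : M.Cfg) : Option M.Cfg :=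
  (M.trans c.state (Transducer.inputCell x c.pos) (decide (c.ctr = 0))).map fun r =>
    { state := r.1
      pos := min (Transducer.moveHead r.2.1 c.pos) (x.length + 1)
      ctr := r.2.2.1.apply c.ctr
      out := c.out ++ r.2.2.2 }

/-- `c'` can be reached from `c` in any number of steps. -/
def Reach (M : CounterTransducer A B) (x : List A) : M.Cfg → M.Cfg → Prop :=
  Relation.ReflTransGen fun c₁ c₂ => c₂ ∈ M.step x c₁

/-- The initial configuration: the head is on the left end marker. -/
def init (M : CounterTransducer A B) : M.Cfg := ⟨M.start, 0, 0, []⟩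

theorem pos_le {M : CounterTransducer A B} {x : List A} {c : M.Cfg} (h : M.Reach x M.init c) :
    c.pos ≤ x.length + 1 := by
  induction h with
  | refl => exact Nat.zero_le _
  | tail _ h _ =>
    obtain ⟨r, _, rfl⟩ := Option.map_eq_some_iff.1 h
    exact min_le_right _ _

/-! ### Counters in bijective base two -/

/-- The number with the given digits in bijective base two: the digits are one (`false`) and two
(`true`), the least significant first. As there are no leading zeros, a counter is zero if and only
if its first cell is blank. -/
def value : List Bool → ℕ
  | [] => 0
  | b :: l => (if b then 2 else 1) + 2 * value l

/-- Increment: digits two become one and carry. -/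
def incDigits : List Bool → List Bool
  | [] => [false]
  | false :: l => true :: l
  | true :: l => false :: incDigits l

/-- Decrement: digits one become two and borrow; a leading digit one that has to borrow is dropped.
-/
def decDigits : List Bool → List Bool
  | [] => []
  | true :: l => false :: l
  | [false] => []
  | false :: b :: l => true :: decDigits (b :: l)

theorem value_incDigits (l : List Bool) : value (incDigits l) = value l + 1 := by
  induction l with
  | nil => rfl
  | cons b l ih => cases b <;> simp [incDigits, value, ih] <;> ring

theorem value_eq_zero {l : List Bool} : value l = 0 ↔ l = [] := by
  cases l with
  | nil => simp [value]
  | cons b l => cases b <;> simp [value]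

theorem value_decDigits (l : List Bool) : value (decDigits l) = value l - 1 := by
  induction l with
  | nil => rfl
  | cons b l ih =>
    cases b
    · cases l with
      | nil => rfl
      | cons b l =>
        have : value (b :: l) ≠ 0 := by simp [value_eq_zero]
        have e : ∀ m, value (true :: m) = 2 + 2 * value m := fun _ => rfl
        have e' : ∀ m, value (false :: m) = 1 + 2 * value m := fun _ => rfl
        rw [decDigits, e, ih, e']
        omega
    · simp only [decDigits, value, if_true, Bool.false_eq_true, if_false]
      omega

/-- The number of digits is logarithmic in the value. -/
theorem two_pow_length_le (l : List Bool) : 2 ^ l.length ≤ value l + 1 := by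
  induction l with
  | nil => simp [value]
  | cons b l ih =>
    rw [List.length_cons, pow_succ, value]
    split_ifs <;> omega

/-- Work symbols: a mark for cell `0`, and the digits from cell `1` on. -/
inductive CtrSym : Type
  | blank
  | mark
  | digit (b : Bool)

instance : Finite CtrSym :=
  Finite.of_surjective (fun i : Option (Option Bool) => match i with
      | none => CtrSym.blank
      | some none => CtrSym.mark
      | some (some b) => CtrSym.digit b)
    (fun q => by cases q; exacts [⟨none, rfl⟩, ⟨some none, rfl⟩, ⟨some (some _), rfl⟩])

/-- The test for the blank. -/
def CtrSym.isBlank : CtrSym → Bool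
  | blank => true
  | _ => false

/-- The work tape that holds the given digits. -/
def tape (l : List Bool) (i : ℕ) : CtrSym :=
  if i = 0 then .mark
  else match l[i - 1]? with
    | some b => .digit b
    | none => .blank

theorem tape_zero (l : List Bool) : tape l 0 = .mark := rfl

theorem tape_append_cons (l m : List Bool) (b : Bool) :
    tape (l ++ b :: m) (l.length + 1) = .digit b := by
  simp [tape]

theorem tape_length (l : List Bool) : tape l (l.length + 1) = .blank := by
  simp [tape]

theorem isBlank_tape_one (l : List Bool) : (tape l 1).isBlank = decide (value l = 0) := by
  cases l with
  | nil => rfl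
  | cons b l =>
    have : value (b :: l) ≠ 0 := by simp [value_eq_zero]
    rw [decide_eq_false this]
    rfl

theorem exists_tape_eq_digit {l : List Bool} {i : ℕ} (h : i + 1 ≤ l.length) :
    ∃ b, tape l (i + 1) = .digit b :=
  ⟨l[i], by simp [tape, List.getElem?_eq_getElem h]⟩

theorem update_tape_cons (l m : List Bool) (b b' : Bool) :
    Function.update (tape (l ++ b :: m)) (l.length + 1) (.digit b') = tape (l ++ b' :: m) := by
  funext i
  by_cases h : i = l.length + 1
  · subst h
    rw [Function.update_self, tape_append_cons]
  · rw [Function.update_of_ne h]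
    rcases i with _ | i
    · rfl
    · simp only [tape, Nat.add_sub_cancel]
      rcases lt_trichotomy i l.length with h' | h' | h'
      · simp [List.getElem?_append_left h']
      · omega
      · obtain ⟨j, rfl⟩ := Nat.exists_eq_add_of_lt h'
        simp [List.getElem?_append_right, add_assoc]

theorem update_tape_append (l : List Bool) (b : Bool) :
    Function.update (tape l) (l.length + 1) (.digit b) = tape (l ++ [b]) := by
  funext i
  by_cases h : i = l.length + 1
  · subst h
    rw [Function.update_self, tape_append_cons]
  · rw [Function.update_of_ne h]
    rcases i with _ | i
    · rfl
    · simp only [tape, Nat.add_sub_cancel]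
      rcases lt_trichotomy i l.length with h' | h' | h'
      · simp [List.getElem?_append_left h']
      · omega
      · rw [List.getElem?_eq_none h'.le, List.getElem?_eq_none (by simpa using h')]

theorem update_tape_blank (l : List Bool) (b : Bool) :
    Function.update (tape (l ++ [b])) (l.length + 1) .blank = tape l := by
  rw [← update_tape_append, Function.update_idem, ← tape_length, Function.update_eq_self]

/-! ### Simulation by a logspace Turing machine -/

/-- The kinds of head movements on the work tape: carrying to the right for an increment or a
decrement, erasing the last digit, returning to the mark. -/
inductive Walk : Type
  | inc
  | dec
  | erase
  | back

instance : Finite Walk :=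
  Finite.of_surjective (fun i : Fin 4 => match i with
      | 0 => Walk.inc
      | 1 => Walk.dec
      | 2 => Walk.erase
      | 3 => Walk.back)
    (fun q => by cases q; exacts [⟨0, rfl⟩, ⟨1, rfl⟩, ⟨2, rfl⟩, ⟨3, rfl⟩])

/-- States of the simulating Turing machine: `rest q` if the counter machine is in state `q`,
and, between two such states, `emit` while a word is written and then `walk` while the counter is
changed. -/
inductive Phase (M : CounterTransducer A B) : Type
  | init
  | rest (q : M.State)
  | emit (q : M.State) (op : CtrOp) (l : {l : List B // l.length ≤ M.maxOut})
  | walk (k : Walk) (q : M.State)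

theorem finite_phase [Finite B] (M : CounterTransducer A B) : Finite (Phase M) := by
  have := M.finite_state
  have := finite_words B M.maxOut
  exact Finite.of_surjective
    (fun s : Unit ⊕ M.State ⊕ (M.State × CtrOp × {l : List B // l.length ≤ M.maxOut}) ⊕
        (Walk × M.State) => match s with
      | .inl _ => Phase.init
      | .inr (.inl q) => Phase.rest q
      | .inr (.inr (.inl r)) => Phase.emit r.1 r.2.1 r.2.2
      | .inr (.inr (.inr r)) => Phase.walk r.1 r.2)
    (fun s => by
      cases s with
      | init => exact ⟨.inl (), rfl⟩
      | rest q => exact ⟨.inr (.inl q), rfl⟩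
      | emit q op l => exact ⟨.inr (.inr (.inl (q, op, l))), rfl⟩
      | walk k q => exact ⟨.inr (.inr (.inr (k, q))), rfl⟩)

/-- The phase that carries out a change of the counter. -/
def CtrOp.phase {M : CounterTransducer A B} (q : M.State) : CtrOp → Phase M
  | .keep => .rest q
  | .inc => .walk .inc q
  | .dec => .walk .dec q

/-- The transitions of the simulating machine: the new state, the movement on the input tape, the
work symbol and the movement on the work tape, and the letter written. -/
def phaseTrans (M : CounterTransducer A B) :
    Phase M → InCell A → CtrSym → Option (Phase M × Dir × (CtrSym × Dir) × Option B)
  | .init, _, _ => some (.rest M.start, .stay, (.mark, .right), none)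
  | .rest q, c, a =>
      (M.trans q c a.isBlank).map fun r =>
        (.emit r.1 r.2.2.1 ⟨r.2.2.2.take M.maxOut, List.length_take_le _ _⟩, r.2.1, (a, .stay),
          none)
  | .emit q op ⟨[], _⟩, _, a => some (CtrOp.phase q op, .stay, (a, .stay), none)
  | .emit q op ⟨b :: l, h⟩, _, a =>
      some (.emit q op ⟨l, (Nat.le_succ _).trans h⟩, .stay, (a, .stay), some b)
  | .walk .inc q, _, .digit true => some (.walk .inc q, .stay, (.digit false, .right), none)
  | .walk .inc q, _, .digit false => some (.walk .back q, .stay, (.digit true, .left), none)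
  | .walk .inc q, _, .blank => some (.walk .back q, .stay, (.digit false, .left), none)
  | .walk .inc _, _, .mark => none
  | .walk .dec q, _, .digit false => some (.walk .dec q, .stay, (.digit true, .right), none)
  | .walk .dec q, _, .digit true => some (.walk .back q, .stay, (.digit false, .left), none)
  | .walk .dec q, _, .blank => some (.walk .erase q, .stay, (.blank, .left), none)
  | .walk .dec _, _, .mark => none
  | .walk .erase q, _, .mark => some (.rest q, .stay, (.mark, .right), none)
  | .walk .erase q, _, _ => some (.walk .back q, .stay, (.blank, .left), none)
  | .walk .back q, _, .mark => some (.rest q, .stay, (.mark, .right), none)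
  | .walk .back q, _, a => some (.walk .back q, .stay, (a, .left), none)

variable [Finite A] [Finite B]

/-- The Turing machine with one work tape that simulates a counter machine. -/
def toTransducer (M : CounterTransducer A B) : Transducer A B where
  State := Phase M
  finite_state := finite_phase M
  start := .init
  Work := CtrSym
  finite_work := inferInstance
  blank := .blank
  tapes := 1
  trans q c w := (phaseTrans M q c (w 0)).map fun r => (r.1, r.2.1, fun _ => r.2.2.1, r.2.2.2)

/-- The configuration with the given state, input position, work tape, work head and output. -/
def tmCfg (M : CounterTransducer A B) (p : Phase M) (i : ℕ) (T : ℕ → CtrSym) (h : ℕ)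
    (o : List B) : M.toTransducer.Cfg :=
  ⟨p, i, fun _ => T, fun _ => h, o⟩

theorem step_tmCfg (M : CounterTransducer A B) (x : List A) (p : Phase M) (i : ℕ)
    (T : ℕ → CtrSym) (h : ℕ) (o : List B) :
    M.toTransducer.step x (M.tmCfg p i T h o) =
      (phaseTrans M p (Transducer.inputCell x i) (T h)).map fun r =>
        M.tmCfg r.1 (min (Transducer.moveHead r.2.1 i) (x.length + 1))
          (Function.update T h r.2.2.1.1) (Transducer.moveHead r.2.2.1.2 h)
          (o ++ r.2.2.2.toList) := by
  unfold Transducer.step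
  have e : M.toTransducer.trans (M.tmCfg p i T h o).state
      (Transducer.inputCell x (M.tmCfg p i T h o).inputPos)
      (fun j => (M.tmCfg p i T h o).work j ((M.tmCfg p i T h o).head j)) =
      (phaseTrans M p (Transducer.inputCell x i) (T h)).map
        fun r => (r.1, r.2.1, fun _ => r.2.2.1, r.2.2.2) := rfl
  rw [e]
  cases phaseTrans M p (Transducer.inputCell x i) (T h) <;> rfl

/-- A step from a configuration in which the work head is at most at cell `b`. -/
def StepIn (M : CounterTransducer A B) (x : List A) (b : ℕ) (c c' : M.toTransducer.Cfg) : Prop :=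
  c' ∈ M.toTransducer.step x c ∧ ∀ j, c.head j ≤ b

section Simulation

variable {M : CounterTransducer A B} {x : List A} {b i : ℕ} {o : List B} {q : M.State}

theorem stepIn_of_trans {p p' : Phase M} {T : ℕ → CtrSym} {h : ℕ} {a : CtrSym} {d : Dir}
    {l : Option B} (hi : i ≤ x.length + 1) (hh : h ≤ b)
    (ht : phaseTrans M p (Transducer.inputCell x i) (T h) = some (p', .stay, (a, d), l)) :
    M.StepIn x b (M.tmCfg p i T h o)
      (M.tmCfg p' i (Function.update T h a) (Transducer.moveHead d h) (o ++ l.toList)) := by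
  refine ⟨?_, fun _ => hh⟩
  rw [step_tmCfg, ht, Option.map_some, Option.mem_some_iff]
  simp only [Transducer.moveHead, min_eq_left hi]

open Relation

theorem reflTransGen_back (hi : i ≤ x.length + 1) (l : List Bool) (h : ℕ) (hl : h ≤ l.length)
    (hb : h ≤ b) :
    ReflTransGen (M.StepIn x b) (M.tmCfg (.walk .back q) i (tape l) h o)
      (M.tmCfg (.rest q) i (tape l) 1 o) := by
  induction h with
  | zero =>
    refine .single ?_
    have := stepIn_of_trans (M := M) (b := b) (p := .walk .back q) (p' := .rest q) (T := tape l)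
      (h := 0) (a := .mark) (d := .right) (l := none) (o := o) hi hb rfl
    rwa [← tape_zero l, Function.update_eq_self, Option.toList_none, List.append_nil] at this
  | succ h ih =>
    refine .head ?_ (ih (by omega) (by omega))
    obtain ⟨c, hc⟩ := exists_tape_eq_digit hl
    have := stepIn_of_trans (M := M) (b := b) (p := .walk .back q) (p' := .walk .back q)
      (T := tape l) (h := h + 1) (a := .digit c) (d := .left) (l := none) (o := o) hi hb
      (by rw [hc]; rfl)
    rwa [← hc, Function.update_eq_self, Option.toList_none, List.append_nil] at this

theorem reflTransGen_inc (hi : i ≤ x.length + 1) (l m : List Bool)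
    (hb : l.length + m.length + 1 ≤ b) :
    ReflTransGen (M.StepIn x b) (M.tmCfg (.walk .inc q) i (tape (l ++ m)) (l.length + 1) o)
      (M.tmCfg (.rest q) i (tape (l ++ incDigits m)) 1 o) := by
  induction m generalizing l with
  | nil =>
    rw [List.append_nil]
    refine .head ?_ (reflTransGen_back hi _ l.length (by simp) (by simp at hb; omega))
    have := stepIn_of_trans (M := M) (b := b) (p := .walk .inc q) (p' := .walk .back q)
      (T := tape l) (h := l.length + 1) (a := .digit false) (d := .left) (l := none) (o := o) hi
      (by simp at hb; omega) (by rw [tape_length]; rfl)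
    rwa [update_tape_append, Option.toList_none, List.append_nil] at this
  | cons c m ih =>
    rw [List.length_cons] at hb
    cases c
    · refine .head ?_ (reflTransGen_back hi _ l.length (by simp) (by omega))
      have := stepIn_of_trans (M := M) (b := b) (p := .walk .inc q) (p' := .walk .back q)
        (T := tape (l ++ false :: m))
        (h := l.length + 1) (a := .digit true) (d := .left) (l := none) (o := o) hi
        (by omega) (by rw [tape_append_cons]; rfl)
      rwa [update_tape_cons, Option.toList_none, List.append_nil] at this
    · have ih := ih (l ++ [false]) (by rw [List.length_append, List.length_singleton]; omega)
      rw [List.append_assoc, List.append_assoc, List.length_append] at ih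
      refine .head ?_ ih
      have := stepIn_of_trans (M := M) (b := b) (p := .walk .inc q) (p' := .walk .inc q)
        (T := tape (l ++ true :: m))
        (h := l.length + 1) (a := .digit false) (d := .right) (l := none) (o := o) hi
        (by omega) (by rw [tape_append_cons]; rfl)
      rwa [update_tape_cons, Option.toList_none, List.append_nil] at this

theorem reflTransGen_dec_aux (hi : i ≤ x.length + 1) (l m : List Bool) (hm : m ≠ [])
    (hb : l.length + m.length + 1 ≤ b) :
    ReflTransGen (M.StepIn x b) (M.tmCfg (.walk .dec q) i (tape (l ++ m)) (l.length + 1) o)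
      (M.tmCfg (.rest q) i (tape (l ++ decDigits m)) 1 o) := by
  induction m generalizing l with
  | nil => exact absurd rfl hm
  | cons c m ih =>
    rw [List.length_cons] at hb
    cases c
    · have h1 := stepIn_of_trans (M := M) (b := b) (p := .walk .dec q) (p' := .walk .dec q)
        (T := tape (l ++ false :: m))
        (h := l.length + 1) (a := .digit true) (d := .right) (l := none) (o := o) hi
        (by omega) (by rw [tape_append_cons]; rfl)
      rw [update_tape_cons, Option.toList_none, List.append_nil] at h1
      refine .head h1 ?_
      cases m with
      | nil =>
        -- The borrow runs past the leading digit, which is then erased.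
        have h2 := stepIn_of_trans (M := M) (b := b) (p := .walk .dec q) (p' := .walk .erase q)
          (T := tape (l ++ [true]))
          (h := l.length + 2) (a := .blank) (d := .left) (l := none) (o := o) hi
          (by simp at hb; omega) (by
            have := tape_length (l ++ [true])
            rw [List.length_append] at this
            rw [show l.length + 2 = l.length + [true].length + 1 from rfl, this]; rfl)
        have e := tape_length (l ++ [true])
        rw [List.length_append] at e
        have e' : Function.update (tape (l ++ [true])) (l.length + 2) .blank =
            tape (l ++ [true]) := by
          rw [← e]; exact Function.update_eq_self _ _
        rw [e', Option.toList_none, List.append_nil] at h2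
        have h3 := stepIn_of_trans (M := M) (b := b) (p := .walk .erase q) (p' := .walk .back q)
          (T := tape (l ++ [true]))
          (h := l.length + 1) (a := .blank) (d := .left) (l := none) (o := o) hi
          (by omega) (by rw [tape_append_cons]; rfl)
        rw [update_tape_blank, Option.toList_none, List.append_nil] at h3
        refine .head h2 (.head h3 ?_)
        rw [decDigits, List.append_nil]
        exact reflTransGen_back hi _ l.length le_rfl (by omega)
      | cons c m =>
        have ih := ih (l ++ [true]) (by simp)
          (by rw [List.length_append, List.length_singleton]; omega)
        rwa [List.append_assoc, List.append_assoc, List.length_append] at ih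
    · refine .head ?_ (reflTransGen_back hi _ l.length (by simp [decDigits]) (by omega))
      have := stepIn_of_trans (M := M) (b := b) (p := .walk .dec q) (p' := .walk .back q)
        (T := tape (l ++ true :: m))
        (h := l.length + 1) (a := .digit false) (d := .left) (l := none) (o := o) hi
        (by omega) (by rw [tape_append_cons]; rfl)
      rwa [update_tape_cons, Option.toList_none, List.append_nil] at this

theorem reflTransGen_dec (hi : i ≤ x.length + 1) (l : List Bool) (hb : l.length + 1 ≤ b) :
    ReflTransGen (M.StepIn x b) (M.tmCfg (.walk .dec q) i (tape l) 1 o)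
      (M.tmCfg (.rest q) i (tape (decDigits l)) 1 o) := by
  cases l with
  | nil =>
    -- A decrement of zero meets the mark instead of a digit to be erased.
    have h1 := stepIn_of_trans (M := M) (b := b) (p := .walk .dec q) (p' := .walk .erase q)
      (T := tape []) (h := 1) (a := .blank) (d := .left) (l := none) (o := o) hi hb rfl
    have h2 := stepIn_of_trans (M := M) (b := b) (p := .walk .erase q) (p' := .rest q)
      (T := tape []) (h := 0) (a := .mark) (d := .right) (l := none) (o := o) hi (Nat.zero_le _) rfl
    have e1 : Function.update (tape []) 1 .blank = tape [] := Function.update_eq_self 1 (tape [])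
    have e2 : Function.update (tape []) 0 .mark = tape [] := Function.update_eq_self 0 (tape [])
    rw [e1, Option.toList_none, List.append_nil] at h1
    rw [e2, Option.toList_none, List.append_nil] at h2
    exact .head h1 (.head h2 .refl)
  | cons c l => exact reflTransGen_dec_aux hi [] (c :: l) (by simp) (by simpa using hb)

theorem reflTransGen_ctrOp (hi : i ≤ x.length + 1) (op : CtrOp) (l : List Bool)
    (hb : l.length + 1 ≤ b) :
    ∃ l', value l' = op.apply (value l) ∧
      ReflTransGen (M.StepIn x b) (M.tmCfg (CtrOp.phase q op) i (tape l) 1 o)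
        (M.tmCfg (.rest q) i (tape l') 1 o) := by
  cases op with
  | keep => exact ⟨l, rfl, .refl⟩
  | inc => exact ⟨_, value_incDigits l, reflTransGen_inc hi [] l (by simpa using hb)⟩
  | dec => exact ⟨_, value_decDigits l, reflTransGen_dec hi l hb⟩

theorem reflTransGen_emit (hi : i ≤ x.length + 1) (op : CtrOp) (w : List B)
    (hw : w.length ≤ M.maxOut) (T : ℕ → CtrSym) (h : ℕ) (hb : h ≤ b) :
    ReflTransGen (M.StepIn x b) (M.tmCfg (.emit q op ⟨w, hw⟩) i T h o)
      (M.tmCfg (CtrOp.phase q op) i T h (o ++ w)) := by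
  induction w generalizing o with
  | nil =>
    refine .single ?_
    have := stepIn_of_trans (M := M) (b := b) (p := .emit q op ⟨[], hw⟩) (p' := CtrOp.phase q op)
      (T := T) (h := h) (a := T h) (d := .stay) (l := none) (o := o) hi hb rfl
    rwa [Function.update_eq_self] at this
  | cons c w ih =>
    have := stepIn_of_trans (M := M) (b := b) (p := .emit q op ⟨c :: w, hw⟩)
      (p' := .emit q op ⟨w, (Nat.le_succ _).trans hw⟩) (T := T)
      (h := h) (a := T h) (d := .stay) (l := some c) (o := o) hi hb rfl
    rw [Function.update_eq_self] at this
    have ih := ih (o := o ++ [c]) ((Nat.le_succ _).trans hw)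
    rw [List.append_assoc] at ih
    exact .head this ih

theorem step_eq_none (l : List Bool) (h : M.step x ⟨q, i, value l, o⟩ = none) :
    M.toTransducer.step x (M.tmCfg (.rest q) i (tape l) 1 o) = none := by
  have h' := Option.map_eq_none_iff.1 h
  rw [step_tmCfg, phaseTrans, Option.map_eq_none_iff, Option.map_eq_none_iff, isBlank_tape_one]
  exact h'

/-- One step of the counter machine takes a positive number of steps of the Turing machine. -/
theorem transGen_of_step (l : List Bool) (hb : l.length + 1 ≤ b) {c' : M.Cfg}
    (h : c' ∈ M.step x ⟨q, i, value l, o⟩) :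
    ∃ l', value l' = c'.ctr ∧
      TransGen (M.StepIn x b) (M.tmCfg (.rest q) i (tape l) 1 o)
        (M.tmCfg (.rest c'.state) c'.pos (tape l') 1 c'.out) := by
  obtain ⟨⟨q', d, op, w⟩, hr, rfl⟩ := Option.map_eq_some_iff.1 h
  have hw := M.length_le _ _ _ _ hr
  have hi' : min (Transducer.moveHead d i) (x.length + 1) ≤ x.length + 1 := min_le_right _ _
  obtain ⟨l', hl', hrun⟩ := reflTransGen_ctrOp (M := M) (q := q') (o := o ++ w) hi' op l hb
  refine ⟨l', hl', .head' ⟨?_, fun _ => ?_⟩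
    ((reflTransGen_emit hi' op w hw (tape l) 1 (by omega)).trans hrun)⟩
  · rw [step_tmCfg, phaseTrans, isBlank_tape_one, hr]
    simp only [Option.map_some, Option.mem_some_iff, Function.update_eq_self, Option.toList_none,
      List.append_nil, Transducer.moveHead, List.take_of_length_le hw]
  · change 1 ≤ b
    omega

end Simulation

/-- If every configuration in `G` either is final or leads to another one in `G` through
configurations in `P`, then everything that a configuration in `G` leads to is in `P`. -/
theorem forall_of_macro_steps {α : Type} {f : α → Option α} {P G : α → Prop}
    (hP : ∀ g, G g → P g)
    (hG : ∀ g, G g → f g = none ∨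
      ∃ g', G g' ∧ Relation.TransGen (fun c c' => c' ∈ f c ∧ P c) g g')
    {c d : α} (hc : G c) (h : Relation.ReflTransGen (fun c c' => c' ∈ f c) c d) : P d := by
  have key : ∃ g, G g ∧ Relation.ReflTransGen (fun c c' => c' ∈ f c ∧ P c) d g := by
    induction h with
    | refl => exact ⟨c, hc, .refl⟩
    | @tail d e _ hde ih =>
      obtain ⟨g, hg, hdg⟩ := ih
      rcases Relation.ReflTransGen.cases_head hdg with rfl | ⟨e', ⟨he', _⟩, heg⟩
      · rcases hG d hg with h0 | ⟨g', hg', hdg'⟩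
        · simp [h0] at hde
        · obtain ⟨e', ⟨he', _⟩, heg⟩ := Relation.TransGen.head'_iff.1 hdg'
          cases Option.mem_unique hde he'
          exact ⟨g', hg', heg⟩
      · cases Option.mem_unique hde he'
        exact ⟨g, hg, heg⟩
  obtain ⟨g, hg, hdg⟩ := key
  rcases Relation.ReflTransGen.cases_head hdg with rfl | ⟨_, ⟨_, h⟩, _⟩
  · exact hP _ hg
  · exact h

theorem init_step (M : CounterTransducer A B) (x : List A) :
    M.tmCfg (.rest M.start) 0 (tape []) 1 [] ∈ M.toTransducer.step x M.toTransducer.init := by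
  have e : M.toTransducer.init = M.tmCfg .init 0 (fun _ => .blank) 0 [] := rfl
  rw [e, step_tmCfg, phaseTrans, Option.map_some, Option.mem_some_iff]
  have e' : Function.update (fun _ => CtrSym.blank) 0 .mark = tape [] := by
    funext i
    rcases i with _ | i <;> simp [tape]
  simp [e', Transducer.moveHead]

theorem length_lt_of_value_le {l : List Bool} {n : ℕ} (h : value l ≤ n + 1) :
    l.length + 1 < 4 * (Nat.log 2 n + 1) := by
  have h1 : n < 2 ^ (Nat.log 2 n + 1) := Nat.lt_pow_succ_log_self one_lt_two n
  have h2 : 2 ^ l.length ≤ 2 ^ (Nat.log 2 n + 2) := by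
    have := two_pow_length_le l
    have h3 : 1 ≤ 2 ^ Nat.log 2 n := Nat.one_le_two_pow
    rw [pow_succ] at h1
    rw [pow_add]
    omega
  have := (Nat.pow_le_pow_iff_right one_lt_two).1 h2
  omega

/-- A function is logspace computable if a counter machine computes it whose counter never exceeds
the length of the input (plus one). -/
theorem logspaceComputable (M : CounterTransducer A B)
    (hM : ∀ x c, M.Reach x M.init c → c.ctr ≤ x.length + 1) {α β : Type} {ea : α → List A}
    {eb : β → List B} {f : α → β}
    (hf : ∀ a, ∃ c, M.Reach (ea a) M.init c ∧ M.step (ea a) c = none ∧ c.out = eb (f a)) :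
    LogspaceComputable ea eb f := by
  refine ⟨M.toTransducer, ⟨4, fun x cfg hcfg => ?_⟩, fun a => ?_⟩
  -- Between the configurations that stand for those of the counter machine, the work head goes at
  -- most one cell beyond the digits.
  · let b := 4 * (Nat.log 2 x.length + 1) - 1
    let G : M.toTransducer.Cfg → Prop := fun g => ∃ (c : M.Cfg) (l : List Bool),
      M.Reach x M.init c ∧ value l = c.ctr ∧ g = M.tmCfg (.rest c.state) c.pos (tape l) 1 c.out
    have hlen : ∀ {c : M.Cfg} {l : List Bool}, M.Reach x M.init c → value l = c.ctr →
        l.length + 1 ≤ b := by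
      intro c l hc hl
      have := length_lt_of_value_le (hl.trans_le (hM x c hc))
      omega
    have hP : ∀ g, G g → ∀ j, g.head j ≤ b := by
      rintro _ ⟨c, l, hc, hl, rfl⟩ j
      have := hlen hc hl
      change 1 ≤ b
      omega
    have key : ∀ g, M.toTransducer.Occurs x g → g = M.toTransducer.init ∨ ∀ j, g.head j ≤ b := by
      intro g hg
      rcases Relation.ReflTransGen.cases_head hg with rfl | ⟨c, hc, hcg⟩
      · exact Or.inl rfl
      · cases Option.mem_unique hc (init_step M x)
        refine Or.inr (forall_of_macro_steps (G := G) hP ?_ ⟨M.init, [], .refl, rfl, rfl⟩ hcg)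
        rintro _ ⟨⟨q, i, n, o⟩, l, hc, rfl, rfl⟩
        rcases hs : M.step x ⟨q, i, value l, o⟩ with _ | c'
        · exact Or.inl (step_eq_none l hs)
        · obtain ⟨l', hl', hrun⟩ := transGen_of_step l (hlen hc rfl) hs
          exact Or.inr ⟨_, ⟨c', l', hc.tail hs, hl', rfl⟩, hrun⟩
    intro j
    rcases key cfg hcfg with rfl | h
    · change 0 < _
      omega
    · have := h j
      omega
  · have key : ∀ c, M.Reach (ea a) M.init c → ∃ l, value l = c.ctr ∧
        M.toTransducer.Occurs (ea a) (M.tmCfg (.rest c.state) c.pos (tape l) 1 c.out) := by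
      intro c hc
      induction hc with
      | refl => exact ⟨[], rfl, .single (init_step M _)⟩
      | @tail c c' hc hs ih =>
        obtain ⟨l, hl, hl'⟩ := ih
        obtain ⟨q, i, n, o⟩ := c
        subst hl
        obtain ⟨l', h1, h2⟩ := transGen_of_step l le_rfl hs
        exact ⟨l', h1, hl'.trans
          (Relation.ReflTransGen.mono (fun _ _ h => h.1) _ _ h2.to_reflTransGen)⟩
    obtain ⟨⟨q, i, n, o⟩, h1, h2, h3⟩ := hf a
    obtain ⟨l, rfl, h5⟩ := key _ h1
    exact ⟨_, h5, step_eq_none l h2, h3⟩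

end CounterTransducer

/-! ### The words of translated formulas -/

theorem flatMap_intercalate {α β : Type} (g : α → List β) (sep : List α) (ls : List (List α)) :
    (List.intercalate sep ls).flatMap g =
      List.intercalate (sep.flatMap g) (ls.map fun l => l.flatMap g) := by
  induction ls with
  | nil => rfl
  | cons l ls ih =>
    cases ls with
    | nil => simp
    | cons m ls =>
      rw [List.map_cons, List.map_cons, List.intercalate_cons_cons, List.intercalate_cons_cons,
        List.flatMap_append, List.flatMap_append, ih, List.map_cons]

theorem filterMap_intercalate {α β : Type} (g : α → Option β) (sep : List α)
    (hsep : sep.filterMap g = []) (ls : List (List α)) :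
    (List.intercalate sep ls).filterMap g = (ls.map fun l => l.filterMap g).flatten := by
  induction ls with
  | nil => rfl
  | cons l ls ih =>
    cases ls with
    | nil => simp
    | cons m ls =>
      rw [List.intercalate_cons_cons, List.filterMap_append, List.filterMap_append, ih, hsep]
      simp

namespace BTerm

variable {C : Finset BoolFn} {V : Type}

/-- The word that writes down a term, with gaps for the variables. -/
def items : BTerm C V → List (Sym C ⊕ V)
  | top => [.inl .prop]
  | var v => [.inr v]
  | conn f args => .inl (.conn f) :: .inl .lpar ::
      (List.intercalate [.inl .comma] (List.ofFn fun i => items (args i)) ++ [.inl .rpar])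

theorem encode_inst (σ : V → Formula C) (D : BTerm C V) :
    (D.inst σ).encode = D.items.flatMap (Sum.elim (fun a => [a]) fun v => (σ v).encode) := by
  induction D with
  | top => rfl
  | var v => simp [inst, items]
  | conn f args ih =>
    simp only [inst, items, Formula.encode, List.flatMap_cons, List.flatMap_append,
      flatMap_intercalate, List.map_ofFn, Function.comp_def, ih, Sum.elim_inl, List.flatMap_nil,
      List.append_nil, List.singleton_append]

/-- The gaps in the word of a term are its variables. -/
theorem filterMap_items (D : BTerm C V) : D.items.filterMap Sum.getRight? = D.vars := by
  induction D with
  | top => rfl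
  | var v => rfl
  | conn f args ih =>
    rw [items, vars, List.filterMap_cons_none rfl, List.filterMap_cons_none rfl,
      List.filterMap_append, filterMap_intercalate _ _ rfl, List.map_ofFn]
    simp [Function.comp_def, ih]

end BTerm

theorem eq_map_inl {α β : Type} {l : List (α ⊕ β)} (h : l.filterMap Sum.getRight? = []) :
    ∃ m : List α, l = m.map .inl := by
  induction l with
  | nil => exact ⟨[], rfl⟩
  | cons a l ih =>
    rcases a with a | b
    · obtain ⟨m, rfl⟩ := ih (by simpa using h)
      exact ⟨a :: m, rfl⟩
    · simp at h

theorem eq_map_inl_append {α β : Type} {l : List (α ⊕ β)} {b : β} {bs : List β}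
    (h : l.filterMap Sum.getRight? = b :: bs) :
    ∃ (m : List α) (l' : List (α ⊕ β)), l = m.map .inl ++ .inr b :: l' ∧
      l'.filterMap Sum.getRight? = bs := by
  induction l with
  | nil => simp at h
  | cons a l ih =>
    rcases a with a | b'
    · obtain ⟨m, l', rfl, h'⟩ := ih (by rwa [List.filterMap_cons_none rfl] at h)
      exact ⟨a :: m, l', rfl, h'⟩
    · obtain ⟨rfl, h'⟩ : b' = b ∧ l.filterMap Sum.getRight? = bs := by simpa using h
      exact ⟨[], l, rfl, h'⟩

/-- The word of a read-once term is split by its two variables into three fixed words. -/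
theorem Gadgets.exists_encode_bool {C : Finset BoolFn} (τ : Gadgets C) (s : Bool) :
    ∃ pre mid post : List (Sym C), ∀ φ ψ : Formula C,
      ((τ.bool s).inst fun b => if b then ψ else φ).encode =
        pre ++ (φ.encode ++ (mid ++ (ψ.encode ++ post))) := by
  obtain ⟨p, l, h1, h2⟩ := eq_map_inl_append ((τ.bool s).filterMap_items.trans (τ.vars_bool s))
  obtain ⟨m, l', rfl, h3⟩ := eq_map_inl_append h2
  obtain ⟨q, rfl⟩ := eq_map_inl h3
  refine ⟨p, m, q, fun φ ψ => ?_⟩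
  rw [BTerm.encode_inst, h1]
  have e : ∀ (r : List (Sym C)) (σ : Bool → Formula C),
      (r.map (Sum.inl (β := Bool))).flatMap (Sum.elim (fun a => [a]) fun v => (σ v).encode) =
        r := by
    intro r σ
    induction r with
    | nil => rfl
    | cons a r ih => rw [List.map_cons, List.flatMap_cons, ih]; rfl
  simp only [List.flatMap_append, List.flatMap_cons, e, Sum.elim_inr]
  rfl

namespace Formula

theorem encode_prop_two_mul_add_one {C : Finset BoolFn} (i : ℕ) :
    (prop (2 * i + 1) : Formula C).encode = .prop :: .bit true :: (Nat.bits i).map .bit := by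
  rw [encode, Nat.bit1_bits]
  rfl

variable (φ ψ : Formula stdBase)

theorem encode_notF : (notF φ).encode = .conn notC :: .lpar :: (φ.encode ++ [.rpar]) := by
  rw [notF, encode]
  change _ :: _ :: (List.intercalate _ (List.ofFn (n := 1) fun _ => φ.encode) ++ _) = _
  simp

theorem encode_andF :
    (andF φ ψ).encode = .conn andC :: .lpar :: (φ.encode ++ .comma :: (ψ.encode ++ [.rpar])) := by
  rw [andF, encode]
  change _ :: _ :: (List.intercalate _
    (List.ofFn (n := 2) fun i => (if i.1 = 0 then φ else ψ).encode) ++ _) = _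
  simp [List.intercalate_cons_cons]

theorem encode_orF :
    (orF φ ψ).encode = .conn orC :: .lpar :: (φ.encode ++ .comma :: (ψ.encode ++ [.rpar])) := by
  rw [orF, encode]
  change _ :: _ :: (List.intercalate _
    (List.ofFn (n := 2) fun i => (if i.1 = 0 then φ else ψ).encode) ++ _) = _
  simp [List.intercalate_cons_cons]

end Formula

/-- Heads of compound formulas. -/
def Sym.IsHead {C : Finset BoolFn} : Sym C → Prop
  | conn _ => True
  | op _ => True
  | _ => False

/-- The shape of the words that write down formulas over the standard base. -/
inductive IsWord {C : Finset BoolFn} : List (Sym C) → Prop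
  | prop (l : List Bool) : IsWord (.prop :: l.map .bit)
  | un {a : Sym C} {w : List (Sym C)} (ha : a.IsHead) (hw : IsWord w) :
      IsWord (a :: .lpar :: (w ++ [.rpar]))
  | bin {a : Sym C} {w w' : List (Sym C)} (ha : a.IsHead) (hw : IsWord w) (hw' : IsWord w') :
      IsWord (a :: .lpar :: (w ++ .comma :: (w' ++ [.rpar])))

theorem Formula.isWord_encode (φ : Formula stdBase) : IsWord φ.encode := by
  induction φ using Formula.std_induction with
  | hprop i => exact .prop _
  | hnot φ ih => rw [encode_notF]; exact .un trivial ih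
  | hand φ ψ ih₁ ih₂ => rw [encode_andF]; exact .bin trivial ih₁ ih₂
  | hor φ ψ ih₁ ih₂ => rw [encode_orF]; exact .bin trivial ih₁ ih₂
  | hun Q O φ ih => exact .un trivial ih
  | hbin Q O φ ψ ih₁ ih₂ => exact .bin trivial ih₁ ih₂

/-! ### The translating machine -/

/-- The words from which the translating machine composes its output: `pre s`, `mid s`, `post s`
surround the arguments of a conjunction (`s = true`) or disjunction (`s = false`), and `lit s` is
the word of a literal, with gaps. -/
structure Words (C : Finset BoolFn) where
  pre : Bool → List (Sym C)
  mid : Bool → List (Sym C)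
  post : Bool → List (Sym C)
  lit : Bool → List (Sym C ⊕ Unit)

namespace Words

variable {C : Finset BoolFn} (ω : Words C) (k : ℕ)

/-- The remainder of a literal word that is being written. -/
abbrev Chunk : Type :=
  {l : List (Sym C ⊕ Unit) // l.length ≤ (ω.lit false).length + (ω.lit true).length}

/-- For each temporal operator around the current position, from the inside to the outside, the
part of the literal word that is still to be written when the operator has been left. -/
abbrev Stack : Type := {st : List ω.Chunk // st.length ≤ k}

/-- The whole literal word. -/
def chunk (s : Bool) : ω.Chunk := ⟨ω.lit s, by cases s <;> omega⟩

variable {ω k} in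
/-- Pushing on a full stack has no effect. This does not happen on formulas of temporal depth at
most `k`. -/
def push (l : ω.Chunk) (st : ω.Stack k) : ω.Stack k :=
  if h : st.1.length < k then ⟨l :: st.1, h⟩ else st

variable {ω k} in
/-- The top of a nonempty stack and the rest. -/
def pop : ω.Stack k → Option (ω.Chunk × ω.Stack k)
  | ⟨[], _⟩ => none
  | ⟨l :: st, h⟩ => some (l, ⟨st, (Nat.le_succ _).trans h⟩)

variable {ω k} in
theorem pop_push {l : ω.Chunk} {st : ω.Stack k} (h : st.1.length < k) :
    pop (push l st) = some (l, st) := by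
  rw [push, dif_pos h]
  rfl

variable {ω k} in
theorem length_push {l : ω.Chunk} {st : ω.Stack k} (h : st.1.length < k) :
    (push l st).1.length = st.1.length + 1 := by
  rw [push, dif_pos h]
  rfl

/-- What the machine does without a literal word in hand. The purpose `true` of the last four
modes is to pass a comma, the purpose `false` is to pass a closing parenthesis. -/
inductive Mode : Type
  /-- translating from left to right -/
  | main
  /-- moving to the end of a proposition -/
  | skip
  /-- searching to the left for the parenthesis that opens the current argument list -/
  | scanL (purpose : Bool)
  /-- reading the head symbol of the current argument list -/
  | look (purpose : Bool)
  /-- moving from a head symbol to its parenthesis -/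
  | enter (purpose : Bool)
  /-- searching to the right for the comma or the parenthesis to be passed -/
  | scanR (purpose : Bool)

/-- What the machine does while a literal word is being written. -/
inductive LitMode : Type
  /-- writing the word at a proposition -/
  | lit
  /-- copying the digits of a proposition -/
  | bits
  /-- returning to the first letter of a proposition -/
  | back
  /-- writing the word at a temporal operator -/
  | temp

instance : Finite Mode :=
  Finite.of_surjective (fun i : Fin 6 × Bool => match i with
      | (0, _) => Mode.main
      | (1, _) => Mode.skip
      | (2, c) => Mode.scanL c
      | (3, c) => Mode.look c
      | (4, c) => Mode.enter c
      | (5, c) => Mode.scanR c)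
    (fun q => by
      cases q
      exacts [⟨(0, true), rfl⟩, ⟨(1, true), rfl⟩, ⟨(2, _), rfl⟩, ⟨(3, _), rfl⟩, ⟨(4, _), rfl⟩,
        ⟨(5, _), rfl⟩])

instance : Finite LitMode :=
  Finite.of_surjective (fun i : Fin 4 => match i with
      | 0 => LitMode.lit
      | 1 => LitMode.bits
      | 2 => LitMode.back
      | 3 => LitMode.temp)
    (fun q => by cases q; exacts [⟨0, rfl⟩, ⟨1, rfl⟩, ⟨2, rfl⟩, ⟨3, rfl⟩])

/-- States of the translating machine. The Boolean is the polarity at the current position. -/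
inductive State : Type
  | plain (m : Mode) (s : Bool) (st : ω.Stack k)
  | chunk (m : LitMode) (s : Bool) (st : ω.Stack k) (l : ω.Chunk)

theorem finite_state : Finite (ω.State k) := by
  have : Finite ω.Chunk := finite_words _ _
  have : Finite (ω.Stack k) := finite_words _ _
  exact Finite.of_surjective
    (fun s : (Mode × Bool × ω.Stack k) ⊕ (LitMode × Bool × ω.Stack k × ω.Chunk) => match s with
      | .inl r => State.plain r.1 r.2.1 r.2.2
      | .inr r => State.chunk r.1 r.2.1 r.2.2.1 r.2.2.2)
    (fun s => by
      cases s with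
      | plain m s st => exact ⟨.inl (m, s, st), rfl⟩
      | chunk m s st l => exact ⟨.inr (m, s, st, l), rfl⟩)

open Classical in
/-- Whether a binary connective is translated as a conjunction, depending on the polarity. -/
def conj (f : stdBase) (s : Bool) : Bool := if f = Formula.andC then s else !s

/-- The dual operator for negative polarity. -/
def polOp (s : Bool) (o : CTLOp) : CTLOp := if s then o else o.dual

variable {ω k}

/-- The type of the right-hand sides of transitions. -/
abbrev Action (ω : Words C) (k : ℕ) : Type := Option (ω.State k × Dir × CtrOp × List (Sym C))

open Classical in
/-- Transitions in mode `main`. -/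
def mainTrans (s : Bool) (st : ω.Stack k) : InCell (Sym stdBase) → Action ω k
  | .leftEnd => some (.plain .main s st, .right, .keep, [])
  | .letter .prop => some (.chunk .lit s st (ω.chunk s), .stay, .keep, [])
  | .letter (.conn f) =>
      if f = Formula.notC then some (.plain .main (!s) st, .right, .keep, [])
      else some (.plain .main s st, .right, .keep, ω.pre (conj f s))
  | .letter (.op _) => some (.chunk .temp s st (ω.chunk true), .stay, .keep, [])
  | .letter .lpar => some (.plain .main s st, .right, .keep, [])
  | .letter .comma => some (.plain (.scanL true) s st, .left, .keep, [])
  | .letter .rpar => some (.plain (.scanL false) s st, .left, .keep, [])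
  | _ => none

/-- Transitions in mode `skip`. -/
def skipTrans (s : Bool) (st : ω.Stack k) : InCell (Sym stdBase) → Action ω k
  | .letter .prop => some (.plain .skip s st, .right, .keep, [])
  | .letter (.bit _) => some (.plain .skip s st, .right, .keep, [])
  | _ => some (.plain .main s st, .stay, .keep, [])

/-- Transitions in mode `scanL`. -/
def scanLTrans (c s : Bool) (st : ω.Stack k) : InCell (Sym stdBase) → Bool → Action ω k
  | .letter .rpar, _ => some (.plain (.scanL c) s st, .left, .inc, [])
  | .letter .lpar, true => some (.plain (.look c) s st, .left, .keep, [])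
  | .letter .lpar, false => some (.plain (.scanL c) s st, .left, .dec, [])
  | .letter _, _ => some (.plain (.scanL c) s st, .left, .keep, [])
  | _, _ => none

open Classical in
/-- Transitions in mode `look`: the word that comes between or after the arguments is written. -/
def lookTrans (s : Bool) (st : ω.Stack k) : Bool → InCell (Sym stdBase) → Action ω k
  | true, .letter (.conn f) => some (.plain (.enter true) s st, .right, .keep, ω.mid (conj f s))
  | true, .letter (.op _) => some (.plain (.enter true) s st, .right, .keep, [.comma])
  | false, .letter (.conn f) =>
      if f = Formula.notC then some (.plain (.enter false) (!s) st, .right, .keep, [])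
      else some (.plain (.enter false) s st, .right, .keep, ω.post (conj f s))
  | false, .letter (.op _) =>
      (pop st).map fun r => (.chunk .temp s r.2 r.1, .stay, .keep, [.rpar])
  | _, _ => none

/-- Transitions in mode `scanR`. -/
def scanRTrans (s : Bool) (st : ω.Stack k) : Bool → InCell (Sym stdBase) → Bool → Action ω k
  | c, .letter .lpar, _ => some (.plain (.scanR c) s st, .right, .inc, [])
  | false, .letter .rpar, true => some (.plain .main s st, .right, .keep, [])
  | true, .letter .rpar, true => none
  | c, .letter .rpar, false => some (.plain (.scanR c) s st, .right, .dec, [])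
  | true, .letter .comma, true => some (.plain .main s st, .right, .keep, [])
  | c, .letter _, _ => some (.plain (.scanR c) s st, .right, .keep, [])
  | _, _, _ => none

/-- Transitions while a literal word is written. -/
def chunkTrans (s : Bool) (st : ω.Stack k) : LitMode → ω.Chunk → InCell (Sym stdBase) → Action ω k
  | .lit, ⟨[], _⟩, _ => some (.plain .skip s st, .stay, .keep, [])
  | .lit, ⟨.inl a :: l, h⟩, _ =>
      some (.chunk .lit s st ⟨l, (Nat.le_succ _).trans h⟩, .stay, .keep, [a])
  | .lit, ⟨.inr _ :: l, h⟩, _ =>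
      some (.chunk .bits s st ⟨l, (Nat.le_succ _).trans h⟩, .right, .keep, [.prop, .bit true])
  | .bits, l, .letter (.bit b) => some (.chunk .bits s st l, .right, .keep, [.bit b])
  | .bits, l, _ => some (.chunk .back s st l, .left, .keep, [])
  | .back, l, .letter (.bit _) => some (.chunk .back s st l, .left, .keep, [])
  | .back, l, .letter .prop => some (.chunk .lit s st l, .stay, .keep, [])
  | .back, _, _ => none
  | .temp, ⟨[], _⟩, _ => some (.plain (.enter false) s st, .right, .keep, [])
  | .temp, ⟨.inl a :: l, h⟩, _ =>
      some (.chunk .temp s st ⟨l, (Nat.le_succ _).trans h⟩, .stay, .keep, [a])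
  | .temp, ⟨.inr _ :: l, h⟩, .letter (.op o) =>
      some (.plain .main s (push ⟨l, (Nat.le_succ _).trans h⟩ st), .right, .keep,
        [.op (polOp s o), .lpar])
  | .temp, _, _ => none

/-- The transitions of the translating machine. -/
def trans : ω.State k → InCell (Sym stdBase) → Bool → Action ω k
  | .plain .main s st, a, _ => mainTrans s st a
  | .plain .skip s st, a, _ => skipTrans s st a
  | .plain (.scanL c) s st, a, z => scanLTrans c s st a z
  | .plain (.look c) s st, a, _ => lookTrans s st c a
  | .plain (.enter c) s st, _, _ => some (.plain (.scanR c) s st, .right, .keep, [])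
  | .plain (.scanR c) s st, a, z => scanRTrans s st c a z
  | .chunk m s st l, a, _ => chunkTrans s st m l a

end Words

instance (A : Type) [Finite A] : Finite (InCell A) :=
  Finite.of_surjective (fun i : Option (Option A) => match i with
      | none => InCell.leftEnd
      | some none => InCell.rightEnd
      | some (some a) => InCell.letter a)
    (fun q => by cases q; exacts [⟨none, rfl⟩, ⟨some (some _), rfl⟩, ⟨some none, rfl⟩])

/-- A finite transition table contains only words of bounded length. -/
theorem exists_length_le {A B S : Type} [Finite A] [Finite S]
    (f : S → InCell A → Bool → Option (S × Dir × CtrOp × List B)) :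
    ∃ n, ∀ q c z r, f q c z = some r → r.2.2.2.length ≤ n := by
  let g : S × InCell A × Bool → ℕ := fun p =>
    ((f p.1 p.2.1 p.2.2).map fun r => r.2.2.2.length).getD 0
  obtain ⟨n, hn⟩ := (Set.finite_range g).bddAbove
  refine ⟨n, fun q c z r hr => ?_⟩
  have := hn ⟨(q, c, z), rfl⟩
  simpa [g, hr] using this

namespace Words

variable {C : Finset BoolFn} {ω : Words C} {k : ℕ}

variable (ω k) in
/-- The translating machine. -/
noncomputable def machine : CounterTransducer (Sym stdBase) (Sym C) where
  State := ω.State k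
  finite_state := ω.finite_state k
  start := .plain .main true ⟨[], Nat.zero_le _⟩
  trans := trans
  maxOut := haveI := ω.finite_state k; (exists_length_le (trans (ω := ω) (k := k))).choose
  length_le := haveI := ω.finite_state k
    (exists_length_le (trans (ω := ω) (k := k))).choose_spec

/-- The counter is zero except in a search, where it changes by at most one per letter. This holds
on all inputs, whether or not they write down formulas. -/
def CtrBound (n : ℕ) : ω.State k → ℕ → ℕ → Prop
  | .plain (.scanL _) _ _, pos, ctr => ctr + pos ≤ n + 1
  | .plain (.scanR _) _ _, pos, ctr => ctr ≤ pos
  | _, _, ctr => ctr = 0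

theorem letter_pos {A : Type} {x : List A} {i : ℕ} {a : A}
    (h : Transducer.inputCell x i = .letter a) : 1 ≤ i ∧ i ≤ x.length := by
  rcases i with _ | i
  · simp [Transducer.inputCell] at h
  · simp only [Transducer.inputCell, Nat.succ_ne_zero, if_false, Nat.add_sub_cancel] at h
    split at h
    · rename_i h'
      exact ⟨Nat.succ_pos _, (List.getElem?_eq_some_iff.1 h').1⟩
    · cases h

theorem ctrBound_step {x : List (Sym stdBase)} {q : ω.State k} {i n : ℕ} (hi : i ≤ x.length + 1)
    (h : CtrBound x.length q i n) {r : ω.State k × Dir × CtrOp × List (Sym C)}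
    (hr : trans q (Transducer.inputCell x i) (decide (n = 0)) = some r) :
    CtrBound x.length r.1 (min (Transducer.moveHead r.2.1 i) (x.length + 1))
      (r.2.2.1.apply n) := by
  have hcell : ∀ a, Transducer.inputCell x i = .letter a → 1 ≤ i ∧ i ≤ x.length :=
    fun a => letter_pos
  generalize Transducer.inputCell x i = c at hr hcell
  rcases q with ⟨m, s, st⟩ | ⟨m, s, st, l⟩
  · cases m with
    | main =>
      obtain rfl : n = 0 := h
      simp only [trans, mainTrans] at hr
      split at hr <;> (try split at hr) <;> cases hr <;>
        simp [CtrBound, CtrOp.apply, Transducer.moveHead]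
    | skip =>
      obtain rfl : n = 0 := h
      simp only [trans, skipTrans] at hr
      split at hr <;> cases hr <;> simp [CtrBound, CtrOp.apply]
    | scanL p =>
      have h : n + i ≤ x.length + 1 := h
      simp only [trans, scanLTrans] at hr
      split at hr <;> cases hr
      · have := hcell _ rfl
        simp [CtrBound, CtrOp.apply, Transducer.moveHead]; omega
      · rename_i hn
        simpa [CtrBound, CtrOp.apply] using hn
      · simp [CtrBound, CtrOp.apply, Transducer.moveHead]; omega
      · simp [CtrBound, CtrOp.apply, Transducer.moveHead]; omega
    | look p =>
      obtain rfl : n = 0 := h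
      simp only [trans, lookTrans] at hr
      split at hr
      · cases hr; simp [CtrBound, CtrOp.apply]
      · cases hr; simp [CtrBound, CtrOp.apply]
      · split at hr <;> cases hr <;> simp [CtrBound, CtrOp.apply]
      · obtain ⟨_, _, rfl⟩ := Option.map_eq_some_iff.1 hr
        simp [CtrBound, CtrOp.apply]
      · cases hr
    | enter p =>
      obtain rfl : n = 0 := h
      cases hr
      simp [CtrBound, CtrOp.apply]
    | scanR p =>
      have h : n ≤ i := h
      simp only [trans, scanRTrans] at hr
      split at hr <;> cases hr
      · have := hcell _ rfl
        simp [CtrBound, CtrOp.apply, Transducer.moveHead]; omega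
      · rename_i hn
        simpa [CtrBound, CtrOp.apply] using hn
      · have := hcell _ rfl
        simp [CtrBound, CtrOp.apply, Transducer.moveHead]; omega
      · rename_i hn
        simpa [CtrBound, CtrOp.apply] using hn
      · have := hcell _ rfl
        simp [CtrBound, CtrOp.apply, Transducer.moveHead]; omega
  · obtain rfl : n = 0 := h
    simp only [trans, chunkTrans] at hr
    split at hr <;> cases hr <;> simp [CtrBound, CtrOp.apply]

theorem ctr_le (x : List (Sym stdBase)) (c : (ω.machine k).Cfg)
    (hc : (ω.machine k).Reach x (ω.machine k).init c) : c.ctr ≤ x.length + 1 := by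
  have key : CtrBound x.length c.state c.pos c.ctr := by
    induction hc with
    | refl => exact rfl
    | tail hc h ih =>
      obtain ⟨r, hr, rfl⟩ := Option.map_eq_some_iff.1 h
      exact ctrBound_step (CounterTransducer.pos_le hc) ih hr
  have := CounterTransducer.pos_le hc
  rcases c with ⟨⟨m, s, st⟩ | ⟨m, s, st, l⟩, i, n, o⟩
  · cases m <;> simp only [CtrBound] at key this ⊢ <;> omega
  · simp only [CtrBound] at key this ⊢
    omega

/-! ### Correctness of the translating machine -/

/-- The word `w` occurs in `x` from index `p` on. -/
def At {A : Type} (x : List A) (p : ℕ) (w : List A) : Prop := ∃ v, x.drop p = w ++ v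

theorem At.left {A : Type} {x : List A} {p : ℕ} {w w' : List A} (h : At x p (w ++ w')) :
    At x p w := by
  obtain ⟨v, hv⟩ := h
  exact ⟨w' ++ v, by rw [hv, List.append_assoc]⟩

theorem At.right {A : Type} {x : List A} {p : ℕ} {w w' : List A} (h : At x p (w ++ w')) :
    At x (p + w.length) w' := by
  obtain ⟨v, hv⟩ := h
  exact ⟨v, by rw [← List.drop_drop, hv, List.append_assoc, List.drop_left]⟩

theorem At.tail {A : Type} {x : List A} {p : ℕ} {a : A} {w : List A} (h : At x p (a :: w)) :
    At x (p + 1) w := At.right (w := [a]) h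

theorem At.cons_left {A : Type} {x : List A} {p : ℕ} {a : A} {w : List A}
    (h : At x p (a :: w)) : At x p [a] := At.left (w := [a]) h

theorem At.add_length_le {A : Type} {x : List A} {p : ℕ} {a : A} {w : List A}
    (h : At x p (a :: w)) : p + (a :: w).length ≤ x.length := by
  obtain ⟨v, hv⟩ := h
  have := congrArg List.length hv
  simp only [List.length_drop, List.length_append, List.length_cons] at this ⊢
  omega

theorem At.head {A : Type} {x : List A} {p : ℕ} {a : A} {w : List A} (h : At x p (a :: w)) :
    x[p]? = some a := by
  obtain ⟨v, hv⟩ := h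
  have : (x.drop p)[0]? = some a := by rw [hv]; rfl
  simpa using this

theorem inputCell_of_getElem? {A : Type} {x : List A} {p : ℕ} {a : A} (h : x[p]? = some a) :
    Transducer.inputCell x (p + 1) = .letter a := by
  simp [Transducer.inputCell, h]

section Steps

variable {x : List (Sym stdBase)} {q q' : ω.State k} {p n : ℕ} {o : List (Sym C)}
  {a : Sym stdBase} {op : CtrOp} {w : List (Sym C)}

/-- Reachability of configurations of the translating machine on input `x`. -/
abbrev Leads (x : List (Sym stdBase)) (c c' : (ω.machine k).Cfg) : Prop :=
  (ω.machine k).Reach x c c'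

variable (p n o) in
/-- The configuration with the given state, head position, counter and output. -/
abbrev cfg (q : ω.State k) : (ω.machine k).Cfg := ⟨q, p, n, o⟩

theorem leads_of_trans {d : Dir}
    (h : trans q (Transducer.inputCell x p) (decide (n = 0)) = some (q', d, op, w)) :
    Leads x (cfg p n o q)
      (cfg (min (Transducer.moveHead d p) (x.length + 1)) (op.apply n) (o ++ w) q') := by
  refine .single ?_
  have h' : (ω.machine k).trans q (Transducer.inputCell x p) (decide (n = 0)) =
      some (q', d, op, w) := h
  rw [CounterTransducer.step, h']
  rfl

theorem leads_right (hx : x[p]? = some a)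
    (h : trans q (.letter a) (decide (n = 0)) = some (q', .right, op, w)) :
    Leads x (cfg (p + 1) n o q) (cfg (p + 2) (op.apply n) (o ++ w) q') := by
  have := leads_of_trans (o := o) (p := p + 1) ((inputCell_of_getElem? hx).symm ▸ h)
  have hp := (List.getElem?_eq_some_iff.1 hx).1
  rwa [Transducer.moveHead, min_eq_left (by omega)] at this

theorem leads_right_nil (hx : x[p]? = some a)
    (h : trans q (.letter a) (decide (n = 0)) = some (q', .right, op, [])) :
    Leads x (cfg (p + 1) n o q) (cfg (p + 2) (op.apply n) o q') := by
  have := leads_right (o := o) hx h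
  rwa [List.append_nil] at this

theorem leads_left (hx : x[p]? = some a)
    (h : trans q (.letter a) (decide (n = 0)) = some (q', .left, op, [])) :
    Leads x (cfg (p + 1) n o q) (cfg p (op.apply n) o q') := by
  have := leads_of_trans (o := o) (p := p + 1) ((inputCell_of_getElem? hx).symm ▸ h)
  have hp := (List.getElem?_eq_some_iff.1 hx).1
  rwa [Transducer.moveHead, min_eq_left (by omega), List.append_nil] at this

theorem leads_stay (hx : x[p]? = some a)
    (h : trans q (.letter a) (decide (n = 0)) = some (q', .stay, op, w)) :
    Leads x (cfg (p + 1) n o q) (cfg (p + 1) (op.apply n) (o ++ w) q') := by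
  have := leads_of_trans (o := o) (p := p + 1) ((inputCell_of_getElem? hx).symm ▸ h)
  have hp := (List.getElem?_eq_some_iff.1 hx).1
  rwa [Transducer.moveHead, min_eq_left (by omega)] at this

theorem leads_stay_nil (hx : x[p]? = some a)
    (h : trans q (.letter a) (decide (n = 0)) = some (q', .stay, op, [])) :
    Leads x (cfg (p + 1) n o q) (cfg (p + 1) (op.apply n) o q') := by
  have := leads_stay (o := o) hx h
  rwa [List.append_nil] at this

end Steps

section Search

variable {x : List (Sym stdBase)} {o : List (Sym C)} {c s : Bool} {st : ω.Stack k}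
  {w : List (Sym stdBase)}

theorem leads_scanL_of_forall (hw : ∀ a ∈ w, a ≠ .lpar ∧ a ≠ .rpar) (p n : ℕ) (h : At x p w) :
    Leads x (cfg (p + w.length) n o (.plain (.scanL c) s st))
      (cfg p n o (.plain (.scanL c) s st)) := by
  induction w generalizing p with
  | nil => exact .refl
  | cons a w ih =>
    have h1 := ih (fun a ha => hw a (List.mem_cons_of_mem _ ha)) (p + 1) h.tail
    have h2 : trans (ω := ω) (k := k) (.plain (.scanL c) s st) (.letter a) (decide (n = 0)) =
        some (.plain (.scanL c) s st, .left, .keep, []) := by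
      have := hw a List.mem_cons_self
      cases a <;> first | rfl | exact absurd rfl this.1 | exact absurd rfl this.2
    rw [List.length_cons, ← add_assoc, add_right_comm]
    exact h1.trans (leads_left h.head h2)

theorem leads_scanR_of_forall (hw : ∀ a ∈ w, a ≠ .lpar ∧ a ≠ .rpar ∧ a ≠ .comma) (p n : ℕ)
    (h : At x p w) :
    Leads x (cfg (p + 1) n o (.plain (.scanR c) s st))
      (cfg (p + w.length + 1) n o (.plain (.scanR c) s st)) := by
  induction w generalizing p with
  | nil => exact .refl
  | cons a w ih =>
    have h1 := ih (fun a ha => hw a (List.mem_cons_of_mem _ ha)) (p + 1) h.tail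
    have h2 : trans (ω := ω) (k := k) (.plain (.scanR c) s st) (.letter a) (decide (n = 0)) =
        some (.plain (.scanR c) s st, .right, .keep, []) := by
      have := hw a List.mem_cons_self
      cases c <;> cases a <;>
        first | rfl | exact absurd rfl this.1 | exact absurd rfl this.2.1 |
          exact absurd rfl this.2.2
    rw [List.length_cons, ← add_assoc, add_right_comm p]
    exact (leads_right_nil h.head h2).trans h1

theorem forall_prop (l : List Bool) :
    ∀ a ∈ (.prop :: l.map .bit : List (Sym stdBase)), a ≠ .lpar ∧ a ≠ .rpar ∧ a ≠ .comma := by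
  intro a ha
  rcases List.mem_cons.1 ha with rfl | ha
  · simp
  · obtain ⟨b, _, rfl⟩ := List.mem_map.1 ha
    simp

theorem ne_of_isHead {a : Sym stdBase} (ha : a.IsHead) : a ≠ .lpar ∧ a ≠ .rpar ∧ a ≠ .comma := by
  cases a <;> simp [Sym.IsHead] at ha ⊢

/-- A search to the left passes a formula without a change of the counter. -/
theorem leads_scanL (hw : IsWord w) (p n : ℕ) (h : At x p w) :
    Leads x (cfg (p + w.length) n o (.plain (.scanL c) s st))
      (cfg p n o (.plain (.scanL c) s st)) := by
  induction hw generalizing p n with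
  | prop l =>
    exact leads_scanL_of_forall (fun a ha => ⟨(forall_prop l a ha).1, (forall_prop l a ha).2.1⟩)
      p n h
  | @un a w ha hw ih =>
    have e : p + (a :: .lpar :: (w ++ [.rpar])).length = p + 1 + 1 + w.length + 1 := by
      simp; omega
    rw [e]
    refine (leads_left h.tail.tail.right.head (op := .inc) rfl).trans ?_
    refine (ih _ _ h.tail.tail.left).trans ?_
    refine (leads_left h.tail.head (op := .dec) rfl).trans ?_
    exact leads_scanL_of_forall (w := [a])
      (by simpa using ⟨(ne_of_isHead ha).1, (ne_of_isHead ha).2.1⟩) p n h.cons_left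
  | @bin a w w' ha hw hw' ih ih' =>
    have e : p + (a :: .lpar :: (w ++ .comma :: (w' ++ [.rpar]))).length =
        p + 1 + 1 + w.length + 1 + w'.length + 1 := by
      simp; omega
    rw [e]
    have h' := h.tail.tail.right.tail
    refine (leads_left h'.right.head (op := .inc) rfl).trans ?_
    refine (ih' _ _ h'.left).trans ?_
    refine (leads_left h.tail.tail.right.head (op := .keep) (by rfl)).trans ?_
    refine (ih _ _ h.tail.tail.left).trans ?_
    refine (leads_left h.tail.head (op := .dec) rfl).trans ?_
    exact leads_scanL_of_forall (w := [a])
      (by simpa using ⟨(ne_of_isHead ha).1, (ne_of_isHead ha).2.1⟩) p n h.cons_left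

theorem trans_scanR_lpar (z : Bool) :
    trans (ω := ω) (k := k) (.plain (.scanR c) s st) (.letter .lpar) z =
      some (.plain (.scanR c) s st, .right, .inc, []) := by
  cases c <;> rfl

theorem trans_scanR_comma (n : ℕ) :
    trans (ω := ω) (k := k) (.plain (.scanR c) s st) (.letter .comma) (decide (n + 1 = 0)) =
      some (.plain (.scanR c) s st, .right, .keep, []) := by
  cases c <;> rfl

theorem trans_scanR_rpar (n : ℕ) :
    trans (ω := ω) (k := k) (.plain (.scanR c) s st) (.letter .rpar) (decide (n + 1 = 0)) =
      some (.plain (.scanR c) s st, .right, .dec, []) := by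
  cases c <;> rfl

/-- A search to the right passes a formula without a change of the counter. -/
theorem leads_scanR (hw : IsWord w) (p n : ℕ) (h : At x p w) :
    Leads x (cfg (p + 1) n o (.plain (.scanR c) s st))
      (cfg (p + w.length + 1) n o (.plain (.scanR c) s st)) := by
  induction hw generalizing p n with
  | prop l => exact leads_scanR_of_forall (forall_prop l) p n h
  | @un a w ha hw ih =>
    have e : p + (a :: .lpar :: (w ++ [.rpar])).length + 1 = p + 1 + 1 + w.length + 2 := by
      simp; omega
    rw [e]
    refine (leads_scanR_of_forall (w := [a]) (by simpa using ne_of_isHead ha)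
      p n h.cons_left).trans ?_
    refine (leads_right_nil h.tail.head (op := .inc) (trans_scanR_lpar _)).trans ?_
    refine (ih _ _ h.tail.tail.left).trans ?_
    exact leads_right_nil h.tail.tail.right.head (op := .dec) (trans_scanR_rpar n)
  | @bin a w w' ha hw hw' ih ih' =>
    have e : p + (a :: .lpar :: (w ++ .comma :: (w' ++ [.rpar]))).length + 1 =
        p + 1 + 1 + w.length + 1 + w'.length + 2 := by
      simp; omega
    rw [e]
    have h' := h.tail.tail.right.tail
    refine (leads_scanR_of_forall (w := [a]) (by simpa using ne_of_isHead ha)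
      p n h.cons_left).trans ?_
    refine (leads_right_nil h.tail.head (op := .inc) (trans_scanR_lpar _)).trans ?_
    refine (ih _ _ h.tail.tail.left).trans ?_
    refine (leads_right_nil h.tail.tail.right.head (op := .keep) (trans_scanR_comma n)).trans ?_
    refine (ih' _ _ h'.left).trans ?_
    exact leads_right_nil h'.right.head (op := .dec) (trans_scanR_rpar n)

/-- Argument lists: one formula, or two formulas separated by a comma. -/
inductive IsArgs : List (Sym stdBase) → Prop
  | one {w : List (Sym stdBase)} (hw : IsWord w) : IsArgs w
  | two {w w' : List (Sym stdBase)} (hw : IsWord w) (hw' : IsWord w') :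
      IsArgs (w ++ .comma :: w')

/-- From behind an argument list the machine finds the head symbol. -/
theorem leads_look (hw : IsArgs w) {a : Sym stdBase} {p : ℕ} (h : At x p (a :: .lpar :: w)) :
    Leads x (cfg (p + 1 + 1 + w.length) 0 o (.plain (.scanL c) s st))
      (cfg (p + 1) 0 o (.plain (.look c) s st)) := by
  refine Relation.ReflTransGen.trans ?_
    (leads_left (q := .plain (.scanL c) s st) (n := 0) h.tail.head (op := .keep) rfl)
  cases hw with
  | one hw => exact leads_scanL hw _ _ h.tail.tail
  | @two w w' hw hw' =>
    have e : p + 1 + 1 + (w ++ .comma :: w').length = p + 1 + 1 + w.length + 1 + w'.length := by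
      simp; omega
    rw [e]
    refine (leads_scanL hw' _ _ h.tail.tail.right.tail).trans ?_
    refine (leads_left h.tail.tail.right.head (op := .keep) (by rfl)).trans ?_
    exact leads_scanL hw _ _ h.tail.tail.left

/-- From a head symbol the machine passes the argument list and its closing parenthesis. -/
theorem leads_enter_rpar (hw : IsArgs w) {a : Sym stdBase} {p : ℕ}
    (h : At x p (a :: .lpar :: (w ++ [.rpar]))) :
    Leads x (cfg (p + 2) 0 o (.plain (.enter false) s st))
      (cfg (p + 1 + 1 + w.length + 2) 0 o (.plain .main s st)) := by
  refine (leads_right_nil h.tail.head (op := .keep) (by rfl)).trans ?_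
  refine Relation.ReflTransGen.trans ?_
    (leads_right_nil (q := .plain (.scanR false) s st) (n := 0) h.tail.tail.right.head
      (op := .keep) rfl)
  cases hw with
  | one hw => exact leads_scanR hw _ _ h.tail.tail.left
  | @two w w' hw hw' =>
    have h' := h.tail.tail.left
    have e : p + 1 + 1 + (w ++ .comma :: w').length + 1 =
        p + 1 + 1 + w.length + 1 + w'.length + 1 := by
      simp; omega
    rw [e]
    refine (leads_scanR hw _ _ h'.left).trans ?_
    refine (leads_right_nil h'.right.head (op := .keep) (by rfl)).trans ?_
    exact leads_scanR hw' _ _ h'.right.tail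

/-- From a head symbol the machine passes the first argument and the comma behind it. -/
theorem leads_enter_comma (hw : IsWord w) {a : Sym stdBase} {p : ℕ} {w' : List (Sym stdBase)}
    (h : At x p (a :: .lpar :: (w ++ .comma :: w'))) :
    Leads x (cfg (p + 2) 0 o (.plain (.enter true) s st))
      (cfg (p + 1 + 1 + w.length + 2) 0 o (.plain .main s st)) := by
  refine (leads_right_nil h.tail.head (op := .keep) (by rfl)).trans ?_
  refine Relation.ReflTransGen.trans ?_
    (leads_right_nil (q := .plain (.scanR true) s st) (n := 0) h.tail.tail.right.head
      (op := .keep) rfl)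
  exact leads_scanR hw _ _ h.tail.tail.left

end Search

open Relation

theorem At.args_left {A : Type} {x : List A} {p : ℕ} {a b : A} {w w' : List A}
    (h : At x p (a :: b :: (w ++ w'))) : At x p (a :: b :: w) := At.left (w := a :: b :: w) h

/-- At index `p` the word ends or has a separator that can follow a formula. -/
def Delim (x : List (Sym stdBase)) (p : ℕ) : Prop :=
  x[p]? = none ∨ x[p]? = some .comma ∨ x[p]? = some .rpar

theorem Delim.cell {x : List (Sym stdBase)} {p : ℕ} (h : Delim x p) :
    Transducer.inputCell x (p + 1) = .rightEnd ∨
      Transducer.inputCell x (p + 1) = .letter .comma ∨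
      Transducer.inputCell x (p + 1) = .letter .rpar := by
  rcases h with h | h | h
  · left; simp [Transducer.inputCell, h]
  · right; left; exact inputCell_of_getElem? h
  · right; right; exact inputCell_of_getElem? h

/-- Putting a word into the gaps of a literal word. -/
abbrev fill (W : List (Sym C)) (l : List (Sym C ⊕ Unit)) : List (Sym C) :=
  l.flatMap (Sum.elim (fun a => [a]) fun _ => W)

variable {x : List (Sym stdBase)} {o : List (Sym C)} {s : Bool} {st : ω.Stack k} {p : ℕ}

/-! ### Propositions -/

section Propositions

variable {l : ω.Chunk}

theorem leads_bits (bs : List Bool) (p : ℕ) (o : List (Sym C)) (h : At x p (bs.map .bit)) :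
    Leads x (cfg (p + 1) 0 o (.chunk .bits s st l))
      (cfg (p + bs.length + 1) 0 (o ++ bs.map .bit) (.chunk .bits s st l)) := by
  induction bs generalizing p o with
  | nil => rw [List.map_nil, List.append_nil]; exact .refl
  | cons b bs ih =>
    have h1 := leads_right (ω := ω) (k := k) (n := 0) (o := o) h.head
      (q := .chunk .bits s st l) (op := .keep) rfl
    have h2 := ih (p + 1) (o ++ [.bit b]) h.tail
    have e : p + (b :: bs).length + 1 = p + 1 + bs.length + 1 := by simp; omega
    rw [List.append_assoc] at h2
    rw [e]
    exact h1.trans h2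

theorem leads_back (bs : List Bool) (p : ℕ) (h : At x p (bs.map .bit)) :
    Leads x (cfg (p + bs.length) 0 o (.chunk .back s st l))
      (cfg p 0 o (.chunk .back s st l)) := by
  induction bs generalizing p with
  | nil => exact .refl
  | cons b bs ih =>
    have h1 := leads_left (ω := ω) (k := k) (n := 0) (o := o) h.head
      (q := .chunk .back s st l) (op := .keep) rfl
    have h2 := ih (p + 1) h.tail
    rw [add_right_comm p] at h2
    exact h2.trans h1

theorem leads_skip (bs : List Bool) (p : ℕ) (h : At x p (bs.map .bit)) :
    Leads x (cfg (p + 1) 0 o (.plain .skip s st))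
      (cfg (p + bs.length + 1) 0 o (.plain .skip s st)) := by
  induction bs generalizing p with
  | nil => exact .refl
  | cons b bs ih =>
    have h1 := leads_right_nil (ω := ω) (k := k) (n := 0) (o := o) h.head
      (q := .plain .skip s st) (op := .keep) rfl
    have e : p + (b :: bs).length + 1 = p + 1 + bs.length + 1 := by simp; omega
    rw [e]
    exact h1.trans (ih (p + 1) h.tail)

theorem leads_lit {bs : List Bool} (h : At x p (.prop :: bs.map .bit))
    (hd : Delim x (p + 1 + bs.length)) (l : List (Sym C ⊕ Unit)) (hl) (o : List (Sym C)) :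
    Leads x (cfg (p + 1) 0 o (.chunk .lit s st ⟨l, hl⟩))
      (cfg (p + 1) 0 (o ++ fill (.prop :: .bit true :: bs.map .bit) l)
        (.chunk .lit s st ⟨[], Nat.zero_le _⟩)) := by
  induction l generalizing o with
  | nil => rw [fill, List.flatMap_nil, List.append_nil]; exact .refl
  | cons a l ih =>
    rw [fill, List.flatMap_cons, ← List.append_assoc]
    refine ReflTransGen.trans ?_ (ih ((Nat.le_succ _).trans hl) _)
    rcases a with a | a
    · exact leads_stay (n := 0) h.head (q := .chunk .lit s st ⟨.inl a :: l, hl⟩) (op := .keep) rfl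
    · have h1 := leads_right (ω := ω) (k := k) (n := 0) (o := o) h.head
        (q := .chunk .lit s st ⟨.inr a :: l, hl⟩) (op := .keep) rfl
      have h2 := leads_bits (s := s) (st := st) (l := ⟨l, (Nat.le_succ _).trans hl⟩) bs (p + 1)
        (o ++ [.prop, .bit true]) h.tail
      have h3 := leads_of_trans (ω := ω) (k := k) (x := x) (n := 0)
        (p := p + 1 + bs.length + 1) (o := o ++ [.prop, .bit true] ++ bs.map .bit) (op := .keep)
        (q := .chunk .bits s st ⟨l, (Nat.le_succ _).trans hl⟩)
        (q' := .chunk .back s st ⟨l, (Nat.le_succ _).trans hl⟩) (d := .left) (w := []) (by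
          rcases hd.cell with h | h | h <;> rw [h] <;> rfl)
      have hle := h.add_length_le
      rw [List.length_cons, List.length_map] at hle
      rw [Transducer.moveHead, min_eq_left (by omega), List.append_nil] at h3
      have h4 := leads_back (o := o ++ [.prop, .bit true] ++ bs.map .bit) (s := s) (st := st)
        (l := ⟨l, (Nat.le_succ _).trans hl⟩) bs (p + 1) h.tail
      have h5 := leads_stay_nil (ω := ω) (k := k) (n := 0)
        (o := o ++ [.prop, .bit true] ++ bs.map .bit) h.head
        (q := .chunk .back s st ⟨l, (Nat.le_succ _).trans hl⟩) (op := .keep) rfl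
      have h := h1.trans (h2.trans (h3.trans (h4.trans h5)))
      rw [List.append_assoc] at h
      exact h

/-- Reading a proposition: its literal word is written, with a copy of the renamed proposition for
each gap. -/
theorem leads_prop {bs : List Bool} (h : At x p (.prop :: bs.map .bit))
    (hd : Delim x (p + 1 + bs.length)) :
    Leads x (cfg (p + 1) 0 o (.plain .main s st))
      (cfg (p + 1 + bs.length + 1) 0 (o ++ fill (.prop :: .bit true :: bs.map .bit) (ω.lit s))
        (.plain .main s st)) := by
  have h1 := leads_stay_nil (ω := ω) (k := k) (n := 0) (o := o) h.head (q := .plain .main s st)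
    (op := .keep) rfl
  have h2 := leads_lit h hd (ω.lit s) (ω.chunk s).2 o (s := s) (st := st)
  refine h1.trans (h2.trans ?_)
  refine (leads_stay_nil (n := 0) h.head (op := .keep) (q' := .plain .skip s st) rfl).trans ?_
  refine (leads_right_nil (n := 0) h.head (op := .keep) (q' := .plain .skip s st) rfl).trans ?_
  refine (leads_skip bs (p + 1) h.tail).trans ?_
  have h3 := leads_of_trans (ω := ω) (k := k) (x := x) (n := 0)
    (p := p + 1 + bs.length + 1) (o := o ++ fill (.prop :: .bit true :: bs.map .bit) (ω.lit s))
    (op := .keep) (q := .plain .skip s st) (q' := .plain .main s st) (d := .stay) (w := []) (by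
      rcases hd.cell with h | h | h <;> rw [h] <;> rfl)
  have hle := h.add_length_le
  rw [List.length_cons, List.length_map] at hle
  rw [Transducer.moveHead, min_eq_left (by omega), List.append_nil] at h3
  exact h3

end Propositions

/-! ### Compound formulas -/

theorem trans_main_notC (z : Bool) :
    trans (.plain .main s st) (.letter (.conn Formula.notC)) z =
      some (.plain .main (!s) st, .right, .keep, []) := by
  simp [trans, mainTrans]

theorem trans_main_conn {f : stdBase} (hf : f ≠ Formula.notC) (z : Bool) :
    trans (.plain .main s st) (.letter (.conn f)) z =
      some (.plain .main s st, .right, .keep, ω.pre (conj f s)) := if_neg hf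

theorem trans_look_notC (z : Bool) :
    trans (.plain (.look false) s st) (.letter (.conn Formula.notC)) z =
      some (.plain (.enter false) (!s) st, .right, .keep, []) := by
  simp [trans, lookTrans]

theorem trans_look_conn {f : stdBase} (hf : f ≠ Formula.notC) (z : Bool) :
    trans (.plain (.look false) s st) (.letter (.conn f)) z =
      some (.plain (.enter false) s st, .right, .keep, ω.post (conj f s)) := if_neg hf

theorem leads_not {w : List (Sym stdBase)} (hw : IsWord w)
    (h : At x p (.conn Formula.notC :: .lpar :: (w ++ [.rpar]))) {u : List (Sym C)}
    (h1 : Leads x (cfg (p + 1 + 1 + 1) 0 o (.plain .main (!s) st))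
      (cfg (p + 1 + 1 + w.length + 1) 0 (o ++ u) (.plain .main (!s) st))) :
    Leads x (cfg (p + 1) 0 o (.plain .main s st))
      (cfg (p + 1 + 1 + w.length + 2) 0 (o ++ u) (.plain .main s st)) := by
  refine (leads_right_nil (n := 0) h.head (op := .keep) (trans_main_notC _)).trans ?_
  refine (leads_right_nil (n := 0) h.tail.head (op := .keep) rfl).trans (h1.trans ?_)
  refine (leads_left (n := 0) h.tail.tail.right.head (op := .keep)
    (q' := .plain (.scanL false) (!s) st) rfl).trans ?_
  refine (leads_look (.one hw) h.args_left).trans ?_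
  have h2 := leads_right_nil (ω := ω) (k := k) (n := 0) (o := o ++ u) h.head (op := .keep)
    (trans_look_notC (s := !s) (st := st) _)
  rw [Bool.not_not] at h2
  exact h2.trans (leads_enter_rpar (.one hw) h)

/-- Reading a conjunction or disjunction, given how its arguments are read. At the comma and at the
closing parenthesis the machine goes back to the head symbol to see which word is due. -/
theorem leads_binary {f : stdBase} (hf : f ≠ Formula.notC) {w w' : List (Sym stdBase)}
    (hw : IsWord w) (hw' : IsWord w')
    (h : At x p (.conn f :: .lpar :: (w ++ .comma :: (w' ++ [.rpar])))) {u u' : List (Sym C)}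
    (h1 : ∀ o, Leads x (cfg (p + 1 + 1 + 1) 0 o (.plain .main s st))
      (cfg (p + 1 + 1 + w.length + 1) 0 (o ++ u) (.plain .main s st)))
    (h2 : ∀ o, Leads x (cfg (p + 1 + 1 + w.length + 1 + 1) 0 o (.plain .main s st))
      (cfg (p + 1 + 1 + w.length + 1 + w'.length + 1) 0 (o ++ u') (.plain .main s st))) :
    Leads x (cfg (p + 1) 0 o (.plain .main s st))
      (cfg (p + 1 + 1 + w.length + 1 + w'.length + 2) 0
        (o ++ (ω.pre (conj f s) ++ (u ++ (ω.mid (conj f s) ++ (u' ++ ω.post (conj f s))))))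
        (.plain .main s st)) := by
  have h' := h.tail.tail.right.tail
  have hA : At x p (.conn f :: .lpar :: ((w ++ .comma :: w') ++ [.rpar])) := by
    rw [List.append_assoc]; exact h
  have e : p + 1 + 1 + (w ++ .comma :: w').length = p + 1 + 1 + w.length + 1 + w'.length := by
    simp; omega
  simp only [← List.append_assoc]
  refine (leads_right (n := 0) h.head (op := .keep) (trans_main_conn hf _)).trans ?_
  refine (leads_right_nil (n := 0) h.tail.head (op := .keep) rfl).trans ((h1 _).trans ?_)
  refine (leads_left (n := 0) h.tail.tail.right.head (op := .keep)
    (q' := .plain (.scanL true) s st) rfl).trans ?_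
  refine (leads_look (.one hw) h.args_left).trans ?_
  refine (leads_right (n := 0) h.head (op := .keep) (q' := .plain (.enter true) s st) rfl).trans ?_
  refine (leads_enter_comma hw h).trans ((h2 _).trans ?_)
  refine (leads_left (n := 0) h'.right.head (op := .keep)
    (q' := .plain (.scanL false) s st) rfl).trans ?_
  have h3 := leads_look (ω := ω) (k := k) (c := false) (s := s) (st := st)
    (o := o ++ ω.pre (conj f s) ++ u ++ ω.mid (conj f s) ++ u') (.two hw hw') hA.args_left
  rw [e] at h3
  refine h3.trans ?_
  refine (leads_right (n := 0) h.head (op := .keep) (trans_look_conn hf _)).trans ?_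
  have h4 := leads_enter_rpar (ω := ω) (k := k) (s := s) (st := st)
    (o := o ++ ω.pre (conj f s) ++ u ++ ω.mid (conj f s) ++ u' ++ ω.post (conj f s))
    (.two hw hw') hA
  rw [e] at h4
  exact h4

/-- If the machine copies the translation `W` of a temporal formula whenever it meets a gap, then
it writes the word of the guarded formula. -/
theorem leads_temp {c : CTLOp} {W : List (Sym C)} (h : x[p]? = some (.op c))
    (hW : ∀ l o, Leads x
      (cfg (p + 2) 0 (o ++ [.op (polOp s c), .lpar]) (.plain .main s (push l st)))
      (cfg (p + 1) 0 (o ++ W) (.chunk .temp s st l)))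
    (l : List (Sym C ⊕ Unit)) (hl) (o : List (Sym C)) :
    Leads x (cfg (p + 1) 0 o (.chunk .temp s st ⟨l, hl⟩))
      (cfg (p + 1) 0 (o ++ fill W l) (.chunk .temp s st ⟨[], Nat.zero_le _⟩)) := by
  induction l generalizing o with
  | nil => rw [fill, List.flatMap_nil, List.append_nil]; exact .refl
  | cons a l ih =>
    rw [fill, List.flatMap_cons, ← List.append_assoc]
    refine ReflTransGen.trans ?_ (ih ((Nat.le_succ _).trans hl) _)
    rcases a with a | a
    · exact leads_stay (n := 0) h (q := .chunk .temp s st ⟨.inl a :: l, hl⟩) (op := .keep) rfl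
    · exact (leads_right (n := 0) h (q := .chunk .temp s st ⟨.inr a :: l, hl⟩) (op := .keep)
        rfl).trans (hW ⟨l, (Nat.le_succ _).trans hl⟩ o)

/-- The guarded translation of a temporal formula, given how its arguments are translated. The copy
in progress is recorded on the stack while the arguments are read. -/
theorem leads_op {c : CTLOp} {w : List (Sym stdBase)} {W : List (Sym C)} (hw : IsArgs w)
    (h : At x p (.op c :: .lpar :: (w ++ [.rpar]))) (hst : st.1.length < k)
    (hW : ∀ l o, Leads x
      (cfg (p + 1 + 1 + 1) 0 o (.plain .main s (push l st)))
      (cfg (p + 1 + 1 + w.length + 1) 0 (o ++ W) (.plain .main s (push l st)))) :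
    Leads x (cfg (p + 1) 0 o (.plain .main s st))
      (cfg (p + 1 + 1 + w.length + 2) 0
        (o ++ fill (.op (polOp s c) :: .lpar :: (W ++ [.rpar])) (ω.lit true))
        (.plain .main s st)) := by
  refine (leads_stay_nil (n := 0) h.head (op := .keep) rfl).trans ?_
  refine (leads_temp (W := .op (polOp s c) :: .lpar :: (W ++ [.rpar])) h.head
    (fun l o => ?_) (ω.lit true) (ω.chunk true).2 o).trans ?_
  · have e : o ++ .op (polOp s c) :: .lpar :: (W ++ [.rpar]) =
        o ++ [.op (polOp s c), .lpar] ++ W ++ [.rpar] := by simp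
    rw [e]
    refine (leads_right_nil (n := 0) h.tail.head (op := .keep) rfl).trans ((hW _ _).trans ?_)
    refine (leads_left (n := 0) h.tail.tail.right.head (op := .keep)
      (q' := .plain (.scanL false) s (push l st)) rfl).trans ?_
    refine (leads_look hw h.args_left).trans ?_
    refine leads_stay (n := 0) h.head (op := .keep) ?_
    change (pop (push l st)).map _ = _
    rw [pop_push hst]
    rfl
  · exact (leads_right_nil (n := 0) h.head (op := .keep) (q' := .plain (.enter false) s st)
      rfl).trans (leads_enter_rpar hw h)

theorem leads_op_comma {c : CTLOp} {w w' : List (Sym stdBase)} {W W' : List (Sym C)}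
    (hw : IsWord w) (h : At x p (.op c :: .lpar :: (w ++ .comma :: w')))
    (h1 : ∀ o, Leads x (cfg (p + 1 + 1 + 1) 0 o (.plain .main s st))
      (cfg (p + 1 + 1 + w.length + 1) 0 (o ++ W) (.plain .main s st)))
    (h2 : ∀ o, Leads x (cfg (p + 1 + 1 + w.length + 1 + 1) 0 o (.plain .main s st))
      (cfg (p + 1 + 1 + w.length + 1 + w'.length + 1) 0 (o ++ W') (.plain .main s st)))
    (o : List (Sym C)) :
    Leads x (cfg (p + 1 + 1 + 1) 0 o (.plain .main s st))
      (cfg (p + 1 + 1 + w.length + 1 + w'.length + 1) 0 (o ++ (W ++ .comma :: W'))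
        (.plain .main s st)) := by
  have e : o ++ (W ++ .comma :: W') = o ++ W ++ [.comma] ++ W' := by simp
  rw [e]
  refine (h1 o).trans ?_
  refine (leads_left (n := 0) h.tail.tail.right.head (op := .keep)
    (q' := .plain (.scanL true) s st) rfl).trans ?_
  refine (leads_look (.one hw) h.args_left).trans ?_
  refine (leads_right (n := 0) h.head (op := .keep) (q' := .plain (.enter true) s st) rfl).trans ?_
  exact (leads_enter_comma hw h).trans (h2 _)

/-- The words of the machine are those of the gadgets. -/
structure Fits (ω : Words C) (τ : Gadgets C) : Prop where
  bool : ∀ (s : Bool) (φ ψ : Formula C), ((τ.bool s).inst fun b => if b then ψ else φ).encode =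
    ω.pre s ++ (φ.encode ++ (ω.mid s ++ (ψ.encode ++ ω.post s)))
  lit : ∀ s, ω.lit s = (τ.lit s).items

theorem exists_fits (τ : Gadgets C) : ∃ ω : Words C, ω.Fits τ := by
  choose pre mid post h using τ.exists_encode_bool
  exact ⟨⟨pre, mid, post, fun s => (τ.lit s).items⟩, h, fun _ => rfl⟩

theorem Fits.encode_lit {τ : Gadgets C} (hω : ω.Fits τ) (s : Bool) (φ : Formula C) :
    ((τ.lit s).inst fun _ => φ).encode = fill φ.encode (ω.lit s) := by
  rw [BTerm.encode_inst, hω.lit]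

/-- Started in front of a formula whose temporal depth does not exceed the free part of the stack,
the machine writes the translation and stops behind the formula. -/
theorem leads_encode {τ : Gadgets C} (hω : ω.Fits τ) (φ : Formula stdBase) (s : Bool)
    (st : ω.Stack k) (p : ℕ) (o : List (Sym C)) (h : At x p φ.encode)
    (hd : Delim x (p + φ.encode.length)) (hst : st.1.length + φ.depth ≤ k) :
    Leads x (cfg (p + 1) 0 o (.plain .main s st))
      (cfg (p + φ.encode.length + 1) 0 (o ++ (τ.tr φ s).encode) (.plain .main s st)) := by
  induction φ using Formula.std_induction generalizing s st p o with
  | hprop i =>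
    rw [Gadgets.tr, hω.encode_lit, Formula.encode_prop_two_mul_add_one]
    have e : p + (Formula.prop i : Formula stdBase).encode.length =
        p + 1 + (Nat.bits i).length := by
      simp [Formula.encode]; omega
    rw [e] at hd ⊢
    exact leads_prop h hd
  | hnot φ ih =>
    rw [Formula.encode_notF] at h hd ⊢
    rw [Formula.depth_notF] at hst
    have e : p + (Sym.conn Formula.notC :: .lpar :: (φ.encode ++ [.rpar])).length + 1 =
        p + 1 + 1 + φ.encode.length + 2 := by
      simp; omega
    rw [e, τ.tr_notF]
    exact leads_not φ.isWord_encode h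
      (ih _ _ _ _ h.tail.tail.left (.inr (.inr h.tail.tail.right.head)) hst)
  | hand φ ψ ih₁ ih₂ =>
    rw [Formula.encode_andF] at h hd ⊢
    rw [Formula.depth_andF] at hst
    have e : p + (Sym.conn Formula.andC :: .lpar ::
        (φ.encode ++ .comma :: (ψ.encode ++ [.rpar]))).length + 1 =
        p + 1 + 1 + φ.encode.length + 1 + ψ.encode.length + 2 := by
      simp; omega
    have h' := h.tail.tail.right.tail
    have key := leads_binary (s := s) (st := st) (o := o) (f := Formula.andC)
      (fun h => Gadgets.andFn_ne_notFn (congrArg Subtype.val h))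
      φ.isWord_encode ψ.isWord_encode h
      (fun o => ih₁ s st _ o h.tail.tail.left (.inr (.inl h.tail.tail.right.head))
        (by have := le_max_left φ.depth ψ.depth; omega))
      (fun o => ih₂ s st _ o h'.left (.inr (.inr h'.right.head))
        (by have := le_max_right φ.depth ψ.depth; omega))
    rw [conj, if_pos rfl, ← hω.bool] at key
    rw [e, τ.tr_andF]
    exact key
  | hor φ ψ ih₁ ih₂ =>
    rw [Formula.encode_orF] at h hd ⊢
    rw [Formula.depth_orF] at hst
    have e : p + (Sym.conn Formula.orC :: .lpar ::
        (φ.encode ++ .comma :: (ψ.encode ++ [.rpar]))).length + 1 =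
        p + 1 + 1 + φ.encode.length + 1 + ψ.encode.length + 2 := by
      simp; omega
    have h' := h.tail.tail.right.tail
    have key := leads_binary (s := s) (st := st) (o := o) (f := Formula.orC)
      (fun h => Gadgets.orFn_ne_notFn (congrArg Subtype.val h))
      φ.isWord_encode ψ.isWord_encode h
      (fun o => ih₁ s st _ o h.tail.tail.left (.inr (.inl h.tail.tail.right.head))
        (by have := le_max_left φ.depth ψ.depth; omega))
      (fun o => ih₂ s st _ o h'.left (.inr (.inr h'.right.head))
        (by have := le_max_right φ.depth ψ.depth; omega))
    rw [conj, if_neg fun h => Gadgets.orFn_ne_andFn (congrArg Subtype.val h), ← hω.bool] at key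
    rw [e, τ.tr_orF]
    exact key
  | hun Q O φ ih =>
    rw [Formula.encode] at h hd ⊢
    rw [Formula.depth] at hst
    have e : p + (Sym.op (C := stdBase) (.un Q O) :: .lpar :: (φ.encode ++ [.rpar])).length + 1 =
        p + 1 + 1 + φ.encode.length + 2 := by
      simp; omega
    have hst' : st.1.length < k := by omega
    have key := leads_op (s := s) (o := o) (.one φ.isWord_encode) h hst'
      (fun l o => ih s (push l st) _ o h.tail.tail.left (.inr (.inr h.tail.tail.right.head))
        (by rw [length_push hst']; omega))
    have e' : polOp s (.un Q O) = .un (Q.pol s) (O.pol s) := by cases s <;> rfl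
    rw [e'] at key
    rw [e, Gadgets.tr, hω.encode_lit]
    exact key
  | hbin Q O φ ψ ih₁ ih₂ =>
    rw [Formula.encode] at h hd ⊢
    rw [Formula.depth] at hst
    have e : p + (Sym.op (C := stdBase) (.bin Q O) :: .lpar ::
        (φ.encode ++ .comma :: (ψ.encode ++ [.rpar]))).length + 1 =
        p + 1 + 1 + (φ.encode ++ .comma :: ψ.encode).length + 2 := by
      simp; omega
    have e₁ : p + 1 + 1 + (φ.encode ++ .comma :: ψ.encode).length + 1 =
        p + 1 + 1 + φ.encode.length + 1 + ψ.encode.length + 1 := by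
      simp; omega
    have h' := h.tail.tail.right.tail
    have hA : At x p (.op (.bin Q O) :: .lpar ::
        ((φ.encode ++ .comma :: ψ.encode) ++ [.rpar])) := by
      rw [List.append_assoc]; exact h
    have hst' : st.1.length < k := by omega
    have key := leads_op (s := s) (o := o) (W := (τ.tr φ s).encode ++ .comma :: (τ.tr ψ s).encode)
      (.two φ.isWord_encode ψ.isWord_encode) hA hst' (fun l o => by
        rw [e₁]
        exact leads_op_comma φ.isWord_encode hA.args_left
          (fun o => ih₁ s (push l st) _ o h.tail.tail.left (.inr (.inl h.tail.tail.right.head))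
            (by rw [length_push hst']; have := le_max_left φ.depth ψ.depth; omega))
          (fun o => ih₂ s (push l st) _ o h'.left (.inr (.inr h'.right.head))
            (by rw [length_push hst']; have := le_max_right φ.depth ψ.depth; omega)) o)
    have e' : polOp s (.bin Q O) = .bin (Q.pol s) (O.pol s) := by cases s <;> rfl
    rw [e', List.append_assoc, List.cons_append] at key
    rw [e, Gadgets.tr, hω.encode_lit]
    exact key

theorem machine_outputs {τ : Gadgets C} (hω : ω.Fits τ) (φ : Formula stdBase) (hφ : φ.depth ≤ k) :
    ∃ c, (ω.machine k).Reach φ.encode (ω.machine k).init c ∧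
      (ω.machine k).step φ.encode c = none ∧ c.out = (τ.tr φ true).encode := by
  have h0 : At φ.encode 0 φ.encode := ⟨[], by simp⟩
  have hend : φ.encode[φ.encode.length]? = none := List.getElem?_eq_none le_rfl
  have h1 := leads_encode (k := k) hω φ true ⟨[], Nat.zero_le _⟩ 0 [] h0
    (.inl (by rw [zero_add]; exact hend)) (by simpa using hφ)
  have h2 := leads_of_trans (ω := ω) (k := k) (x := φ.encode) (p := 0) (n := 0) (o := [])
    (q := .plain .main true ⟨[], Nat.zero_le _⟩) (q' := .plain .main true ⟨[], Nat.zero_le _⟩)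
    (d := .right) (op := .keep) (w := []) rfl
  rw [Transducer.moveHead, min_eq_left (Nat.le_add_left _ _)] at h2
  refine ⟨_, h2.trans h1, ?_, List.nil_append _⟩
  have hc : Transducer.inputCell φ.encode (0 + φ.encode.length + 1) = .rightEnd := by
    rw [zero_add]
    simp [Transducer.inputCell]
  exact Option.map_eq_none_iff.2 ((congrArg (fun c => mainTrans true _ c) hc).trans rfl)

end Words

/-! ### The transfer of fragments -/

/-- The translation as a map between fragments. -/
def Gadgets.trFragment {C : Finset BoolFn} (τ : Gadgets C) (k : ℕ) (T : Set CTLOp)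
    (φ : Fragment k stdBase T) : Fragment k C T :=
  ⟨τ.tr φ.1 true, τ.usesOnly_tr φ.2.1 true, (τ.depth_tr_le φ.1 true).trans φ.2.2⟩

theorem Gadgets.logspaceComputable_trFragment {C : Finset BoolFn} (τ : Gadgets C) (k : ℕ)
    (T : Set CTLOp) :
    LogspaceComputable (encodeIn (Fragment k stdBase T)) (encodeIn (Fragment k C T))
      (τ.trFragment k T) := by
  obtain ⟨ω, hω⟩ := Words.exists_fits τ
  exact CounterTransducer.logspaceComputable (ω.machine k) Words.ctr_le
    fun φ => Words.machine_outputs hω φ.1 φ.2.2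

section FrameEquivalence

variable {C D : Finset BoolFn} {φ : Formula C} {ψ : Formula D}

theorem FrameEquivalent.satisfiable_iff (h : FrameEquivalent.{u} φ ψ) :
    Satisfiable.{u} φ ↔ Satisfiable.{u} ψ := by
  constructor
  · rintro ⟨W, R, V, w, hR, hV⟩
    obtain ⟨V', hV'⟩ := (h W R w hR).1 ⟨V, hV⟩
    exact ⟨W, R, V', w, hR, hV'⟩
  · rintro ⟨W, R, V, w, hR, hV⟩
    obtain ⟨V', hV'⟩ := (h W R w hR).2 ⟨V, hV⟩
    exact ⟨W, R, V', w, hR, hV'⟩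

theorem FrameEquivalent.modelSizes_eq (h : FrameEquivalent.{u} φ ψ) :
    modelSizes.{u} φ = modelSizes.{u} ψ := by
  ext s
  constructor
  · rintro ⟨W, R, V, w, hR, hw, hV, hs⟩
    obtain ⟨V', hV'⟩ := (h W R w hR).1 ⟨V, hV⟩
    exact ⟨W, R, V', w, hR, hw, hV', hs⟩
  · rintro ⟨W, R, V, w, hR, hw, hV, hs⟩
    obtain ⟨V', hV'⟩ := (h W R w hR).2 ⟨V, hV⟩
    exact ⟨W, R, V', w, hR, hw, hV', hs⟩

theorem FrameEquivalent.modelExtents_eq (h : FrameEquivalent.{u} φ ψ) :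
    modelExtents.{u} φ = modelExtents.{u} ψ := by
  ext s
  constructor
  · rintro ⟨W, R, V, w, hR, hw, hV, hs⟩
    obtain ⟨V', hV'⟩ := (h W R w hR).1 ⟨V, hV⟩
    exact ⟨W, R, V', w, hR, hw, hV', hs⟩
  · rintro ⟨W, R, V, w, hR, hw, hV, hs⟩
    obtain ⟨V', hV'⟩ := (h W R w hR).2 ⟨V, hV⟩
    exact ⟨W, R, V', w, hR, hw, hV', hs⟩

end FrameEquivalence

end CTLClone

theorem mainTheorem12 (C : Finset CTLClone.BoolFn)
    (hC : CTLClone.cloneS1 ⊆ CTLClone.cloneOf (C : Set CTLClone.BoolFn))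
    (k : ℕ) (T : Set CTLClone.CTLOp) :
    -- logspace-constructible frame-equivalent formulas of linear size
    (∃ F : CTLClone.Fragment k CTLClone.stdBase T → CTLClone.Fragment k C T,
      CTLClone.LogspaceComputable
        (CTLClone.encodeIn (CTLClone.Fragment k CTLClone.stdBase T))
        (CTLClone.encodeIn (CTLClone.Fragment k C T)) F ∧
      (∀ φ, CTLClone.FrameEquivalent.{u} φ.1 (F φ).1) ∧
      ∃ c : ℕ, ∀ φ, (F φ).1.size ≤ c * φ.1.size) ∧
    -- transfer of complexity lower bounds
    CTLClone.LogspaceReducible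
      (CTLClone.encodeIn (CTLClone.Fragment k CTLClone.stdBase T))
      (CTLClone.SAT.{u} (CTLClone.Fragment k CTLClone.stdBase T))
      (CTLClone.encodeIn (CTLClone.Fragment k C T))
      (CTLClone.SAT.{u} (CTLClone.Fragment k C T)) ∧
    -- transfer of lower bounds on model size and model extent
    (∃ c : ℕ, ∀ (φ : ℕ → CTLClone.Fragment k CTLClone.stdBase T) (s e : ℕ → ℕ∞),
      (∀ n, CTLClone.Satisfiable.{u} (φ n).1 ∧
        IsLeast (CTLClone.modelSizes.{u} (φ n).1) (s n) ∧
        IsLeast (CTLClone.modelExtents.{u} (φ n).1) (e n)) →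
      ∃ φ' : ℕ → CTLClone.Fragment k C T,
        ∀ n, CTLClone.Satisfiable.{u} (φ' n).1 ∧
          IsLeast (CTLClone.modelSizes.{u} (φ' n).1) (s n) ∧
          IsLeast (CTLClone.modelExtents.{u} (φ' n).1) (e n) ∧
          (φ' n).1.size ≤ c * (φ n).1.size) := by
  obtain ⟨τ⟩ := CTLClone.exists_gadgets hC
  obtain ⟨K, hK⟩ := τ.exists_size_tr_le
  have hequiv : ∀ φ : CTLClone.Fragment k CTLClone.stdBase T,
      CTLClone.FrameEquivalent.{u} φ.1 (τ.trFragment k T φ).1 := fun φ => τ.frameEquivalent_tr φ.1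
  have hsize : ∀ φ : CTLClone.Fragment k CTLClone.stdBase T,
      (τ.trFragment k T φ).1.size ≤ (K + 1) ^ (k + 1) * φ.1.size := by
    intro φ
    refine (hK φ.1 true).trans (Nat.mul_le_mul_right _ ?_)
    exact (Nat.pow_le_pow_left (Nat.le_succ K) _).trans
      (Nat.pow_le_pow_right (Nat.succ_pos K) (Nat.succ_le_succ φ.2.2))
  have hlog := τ.logspaceComputable_trFragment k T
  refine ⟨⟨τ.trFragment k T, hlog, hequiv, _, hsize⟩,
    ⟨τ.trFragment k T, hlog, fun φ => (hequiv φ).satisfiable_iff⟩,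
    (K + 1) ^ (k + 1), fun φ s e h => ⟨fun n => τ.trFragment k T (φ n), fun n => ?_⟩⟩
  rw [← (hequiv (φ n)).satisfiable_iff, ← (hequiv (φ n)).modelSizes_eq,
    ← (hequiv (φ n)).modelExtents_eq]
  exact ⟨(h n).1, (h n).2.1, (h n).2.2, hsize (φ n)⟩
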